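/- Let $n\ge 2$ and let $N$ be a convex $(n+3)$-gon with vertices labeled cyclically by $\mathbb{Z}/(n+3)$. A *colored triangulation* $t$ of $N$ is a triangulation of $N$ (using only the vertices of $N$) whose $n$ diagonals are assigned the $n$ colors $1,\dots,n$ bijectively. *Flipping* the diagonal of color $c$ in $t$ means replacing this diagonal, the common edge of two triangles of $t$ forming a quadrilateral, by the other diagonal of that quadrilateral, which receives the same color $c$, and keeping all other colored diagonals. The colorful exchange graph has the colored triangulations as vertices, and an edge of color $c$ joining two colored triangulations whenever one is obtained from the other by flipping the diagonal of color $c$. For a set $C$ of colors and a colored triangulation $t$, the face $(C,t)$ is the set of all colored triangulations that can be reached from $t$ by a path in the exchange graph all of whose edges have colors in $C$. The *colorful $n$-associahedron* $\mathcal{A}^c_n$ is the set consisting of the empty face and all the faces $(C,t)$, partially ordered by inclusion, and $\Gamma(\mathcal{A}^c_n)$ denotes its group of order automorphisms. Then $$\Gamma(\mathcal{A}^c_n)\;\cong\; S_n\times D_{n+3},$$ where $S_n$ is the symmetric group on the colors and $D_{n+3}$ is the dihedral group of order $2(n+3)$, that is, the group of rotations and reflections of $N$. More precisely, there is a group isomorphism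 $\Phi: S_n\times D_{n+3}\to\Gamma(\mathcal{A}^c_n)$ such that, for all $C$ and $t$, $$\Phi(\sigma,1)\big((C,t)\big)=(\sigma(C),t_\sigma)\quad(\sigma\in S_n),\qquad \Phi(1,\gamma)\big((C,t)\big)=(C,t_\gamma)\quad(\gamma\in D_{n+3}),$$ where $t_\sigma$ is obtained from $t$ by replacing each color $c$ by $\sigma(c)$, and $t_\gamma$ is the image of the colored triangulation $t$ under the symmetry $\gamma$ of $N$, with the colors of the diagonals preserved. -/

import Mathlib

namespace ColAssoc

/-! ### The convex polygon and its triangulations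

The vertices of the convex `(n+3)`-gon are the elements of `ZMod (n + 3)`, in their cyclic order
(`sbtw a b c` says that `a`, `b`, `c` are distinct and occur in this cyclic order).
Segments between vertices are unordered pairs. -/

/-- The vertices of the `(n+3)`-gon. -/
abbrev Vertex (n : ℕ) : Type := ZMod (n + 3)

/-- The sides of the polygon: segments between consecutive vertices. -/
def IsSide {n : ℕ} (e : Sym2 (Vertex n)) : Prop :=
  ∃ i : Vertex n, e = s(i, i + 1)

/-- The diagonals of the polygon: segments between distinct, non-consecutive vertices. -/
def IsDiagonal {n : ℕ} (e : Sym2 (Vertex n)) : Prop :=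
  ¬ e.IsDiag ∧ ¬ IsSide e

/-- Two segments cross (meet in the interior of both) if their end points are distinct and
alternate in the cyclic order of the vertices. -/
def Crosses {n : ℕ} (d e : Sym2 (Vertex n)) : Prop :=
  ∃ a b a' b' : Vertex n, d = s(a, a') ∧ e = s(b, b') ∧ sbtw a b a' ∧ sbtw a' b' a

/-- A triangulation of the polygon, given by its set of diagonals: a maximal set of pairwise
non-crossing diagonals. -/
def IsTriangulation {n : ℕ} (T : Set (Sym2 (Vertex n))) : Prop :=
  Maximal (fun S : Set (Sym2 (Vertex n)) =>
    (∀ d ∈ S, IsDiagonal d) ∧ ∀ d ∈ S, ∀ e ∈ S, ¬ Crosses d e) T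

/-- A colored triangulation of the `(n+3)`-gon: a triangulation whose `n` diagonals are in
bijection with the `n` colors; `diag c` is the diagonal of color `c`. -/
@[ext]
structure ColoredTriangulation (n : ℕ) where
  diag : Fin n → Sym2 (Vertex n)
  injective : Function.Injective diag
  isTriangulation : IsTriangulation (Set.range diag)

/-! ### Flips and the exchange graph -/

/-- The edges of (the triangles of) a triangulation: the sides of the polygon, and the diagonals
of the triangulation. -/
def ColoredTriangulation.HasEdge {n : ℕ} (t : ColoredTriangulation n)
    (e : Sym2 (Vertex n)) : Prop :=
  IsSide e ∨ e ∈ Set.range t.diag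

/-- `t'` is obtained from `t` by flipping the diagonal of color `c`: this diagonal `a a'` is the
common edge of two triangles `a b a'` and `a' b' a` of `t`, and it is replaced by the other
diagonal `b b'` of the quadrilateral `a b a' b'`, which receives the same color `c`; all other
diagonals and their colors are kept. -/
def IsFlip {n : ℕ} (c : Fin n) (t t' : ColoredTriangulation n) : Prop :=
  ∃ a b a' b' : Vertex n,
    t.diag c = s(a, a') ∧ t'.diag c = s(b, b') ∧
    sbtw a b a' ∧ sbtw a' b' a ∧
    t.HasEdge s(a, b) ∧ t.HasEdge s(b, a') ∧ t.HasEdge s(a', b') ∧ t.HasEdge s(b', a) ∧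
    ∀ k : Fin n, k ≠ c → t'.diag k = t.diag k

theorem sbtw_iff_val {n : ℕ} (a b c : Vertex n) : sbtw a b c ↔
    a.val < b.val ∧ b.val < c.val ∨ b.val < c.val ∧ c.val < a.val ∨
      c.val < a.val ∧ a.val < b.val :=
  Iff.rfl

theorem ColoredTriangulation.HasEdge.of_flip {n : ℕ} {c : Fin n} {t t' : ColoredTriangulation n}
    (h : ∀ k : Fin n, k ≠ c → t'.diag k = t.diag k) {e : Sym2 (Vertex n)}
    (he : t.HasEdge e) (hne : e ≠ t.diag c) : t'.HasEdge e := by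
  rcases he with he | ⟨k, rfl⟩
  · exact Or.inl he
  · exact Or.inr ⟨k, h k fun hk => hne (by rw [hk])⟩

theorem IsFlip.symm {n : ℕ} {c : Fin n} {t t' : ColoredTriangulation n}
    (h : IsFlip c t t') : IsFlip c t' t := by
  obtain ⟨a, b, a', b', h1, h2, h3, h4, e1, e2, e3, e4, h5⟩ := h
  rw [sbtw_iff_val] at h3 h4
  have n1 : a ≠ b := by rintro rfl; omega
  have n2 : b ≠ a' := by rintro rfl; omega
  have n3 : a' ≠ b' := by rintro rfl; omega
  have n4 : b' ≠ a := by rintro rfl; omega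
  refine ⟨b, a', b', a, h2, h1.trans Sym2.eq_swap, ?_, ?_, e2.of_flip h5 ?_, e3.of_flip h5 ?_,
    e4.of_flip h5 ?_, e1.of_flip h5 ?_, fun k hk => (h5 k hk).symm⟩
  · rw [sbtw_iff_val]; omega
  · rw [sbtw_iff_val]; omega
  all_goals
    rw [h1]
    intro h
    simp only [Sym2.eq_iff] at h
    grind

theorem IsFlip.ne {n : ℕ} {c : Fin n} {t t' : ColoredTriangulation n}
    (h : IsFlip c t t') : t ≠ t' := by
  rintro rfl
  obtain ⟨a, b, a', b', h1, h2, h3, h4, -⟩ := h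
  rw [sbtw_iff_val] at h3 h4
  rw [h1, Sym2.eq_iff] at h2
  rcases h2 with ⟨rfl, rfl⟩ | ⟨rfl, rfl⟩ <;> omega

/-- The subgraph of the colorful exchange graph consisting of the edges with colors in `C`: its
vertices are all colored triangulations, and `t`, `t'` are joined by an edge of color `c` if `t'`
is obtained from `t` by flipping the diagonal of color `c`. For `C = Finset.univ` this is the
colorful exchange graph itself. -/
def exchangeGraph (n : ℕ) (C : Finset (Fin n)) : SimpleGraph (ColoredTriangulation n) where
  Adj t t' := ∃ c ∈ C, IsFlip c t t'
  symm := ⟨fun _ _ ⟨c, hc, h⟩ => ⟨c, hc, h.symm⟩⟩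
  loopless := ⟨fun _ ⟨_, _, h⟩ => h.ne rfl⟩

/-! ### The colorful associahedron -/

/-- The vertex set of the face `(C, t)`: all colored triangulations that can be reached from `t`
by a path in the exchange graph all of whose edges have colors in `C`. -/
def faceSet {n : ℕ} (C : Finset (Fin n)) (t : ColoredTriangulation n) :
    Set (ColoredTriangulation n) :=
  {t' | (exchangeGraph n C).Reachable t t'}

/-- The colorful `n`-associahedron, as the partially ordered set of its faces. Faces are identified
with their vertex sets and ordered by inclusion: they are the empty face, and the faces `(C, t)`
for a set `C` of colors (the rank of the face is the number of these colors) and a colored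
triangulation `t`. -/
abbrev ColorfulAssociahedron (n : ℕ) : Type :=
  {F : Set (ColoredTriangulation n) // F = ∅ ∨ ∃ C t, F = faceSet C t}

/-- The face `(C, t)` of the colorful associahedron. -/
def face {n : ℕ} (C : Finset (Fin n)) (t : ColoredTriangulation n) : ColorfulAssociahedron n :=
  ⟨faceSet C t, Or.inr ⟨C, t, rfl⟩⟩

/-! ### The actions of the symmetric group and of the dihedral group -/

/-- The action of the dihedral group on the vertices of the polygon: `r i` is the rotation
`x ↦ x + i`, and `sr i` is the reflection `x ↦ -(x + i)`. -/
def polygonSymm (n : ℕ) : DihedralGroup (n + 3) →* Equiv.Perm (Vertex n) where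
  toFun
    | .r i => Equiv.addRight i
    | .sr i => (Equiv.addRight i).trans (Equiv.neg _)
  map_one' := by
    ext x
    change x + 0 = x
    simp
  map_mul' := by
    rintro (i | i) (j | j) <;> ext x <;> simp <;> ring

theorem val_add_cases {n : ℕ} (a i : Vertex n) :
    (a + i).val = a.val + i.val ∨ (a + i).val + (n + 3) = a.val + i.val := by
  have := ZMod.val_lt a
  have := ZMod.val_lt i
  rw [ZMod.val_add]
  rcases lt_or_ge (a.val + i.val) (n + 3) with h | h
  · left; exact Nat.mod_eq_of_lt h
  · right
    rw [Nat.mod_eq_sub_mod h, Nat.mod_eq_of_lt (by omega)]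
    omega

theorem sbtw_add {n : ℕ} {a b c : Vertex n} (i : Vertex n) (h : sbtw a b c) :
    sbtw (a + i) (b + i) (c + i) := by
  rw [sbtw_iff_val] at h ⊢
  have := val_add_cases a i
  have := val_add_cases b i
  have := val_add_cases c i
  have := ZMod.val_lt a
  have := ZMod.val_lt b
  have := ZMod.val_lt c
  have := ZMod.val_lt i
  have := ZMod.val_lt (a + i)
  have := ZMod.val_lt (b + i)
  have := ZMod.val_lt (c + i)
  omega

theorem sbtw_neg {n : ℕ} {a b c : Vertex n} (h : sbtw a b c) : sbtw (-c) (-b) (-a) := by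
  rw [sbtw_iff_val] at h ⊢
  have key : ∀ x : Vertex n, (x.val = 0 ∧ (-x).val = 0) ∨ (-x).val + x.val = n + 3 := by
    intro x
    rw [ZMod.neg_val]
    have := ZMod.val_lt x
    split_ifs with hx
    · left; simp [hx]
    · right; omega
  have := key a
  have := key b
  have := key c
  have := ZMod.val_lt a
  have := ZMod.val_lt b
  have := ZMod.val_lt c
  omega

/-- The action of the dihedral group on segments. -/
def moveSegment {n : ℕ} (γ : DihedralGroup (n + 3)) : Sym2 (Vertex n) → Sym2 (Vertex n) :=
  Sym2.map (polygonSymm n γ)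

theorem moveSegment_mk {n : ℕ} (γ : DihedralGroup (n + 3)) (a b : Vertex n) :
    moveSegment γ s(a, b) = s(polygonSymm n γ a, polygonSymm n γ b) := rfl

theorem moveSegment_inv {n : ℕ} (γ : DihedralGroup (n + 3)) (e : Sym2 (Vertex n)) :
    moveSegment γ⁻¹ (moveSegment γ e) = e := by
  induction e with | _ a b => simp [moveSegment_mk]

theorem moveSegment_injective {n : ℕ} (γ : DihedralGroup (n + 3)) :
    Function.Injective (moveSegment γ) :=
  Function.LeftInverse.injective (moveSegment_inv γ)

theorem Crosses.move {n : ℕ} (γ : DihedralGroup (n + 3)) {d e : Sym2 (Vertex n)}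
    (h : Crosses d e) : Crosses (moveSegment γ d) (moveSegment γ e) := by
  obtain ⟨a, b, a', b', rfl, rfl, h1, h2⟩ := h
  rcases γ with i | i
  · exact ⟨a + i, b + i, a' + i, b' + i, rfl, rfl, sbtw_add i h1, sbtw_add i h2⟩
  · exact ⟨-(a' + i), -(b + i), -(a + i), -(b' + i), Sym2.eq_swap, rfl,
      sbtw_neg (sbtw_add i h1), sbtw_neg (sbtw_add i h2)⟩

theorem IsSide.move {n : ℕ} (γ : DihedralGroup (n + 3)) {e : Sym2 (Vertex n)}
    (h : IsSide e) : IsSide (moveSegment γ e) := by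
  obtain ⟨k, rfl⟩ := h
  rcases γ with i | i
  · refine ⟨k + i, ?_⟩
    change s(k + i, k + 1 + i) = _
    rw [show k + 1 + i = k + i + 1 by ring]
  · refine ⟨-(k + 1 + i), ?_⟩
    change s(-(k + i), -(k + 1 + i)) = _
    rw [show -(k + i) = -(k + 1 + i) + 1 by ring]
    exact Sym2.eq_swap

theorem IsDiagonal.move {n : ℕ} (γ : DihedralGroup (n + 3)) {e : Sym2 (Vertex n)}
    (h : IsDiagonal e) : IsDiagonal (moveSegment γ e) := by
  refine ⟨fun hd => h.1 ?_, fun hs => h.2 ?_⟩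
  · induction e with | _ a b => simpa [moveSegment_mk] using hd
  · simpa [moveSegment_inv] using hs.move γ⁻¹

theorem IsTriangulation.move {n : ℕ} (γ : DihedralGroup (n + 3)) {T : Set (Sym2 (Vertex n))}
    (h : IsTriangulation T) : IsTriangulation (moveSegment γ '' T) := by
  have aux : ∀ (δ : DihedralGroup (n + 3)) (S : Set (Sym2 (Vertex n))),
      ((∀ d ∈ S, IsDiagonal d) ∧ ∀ d ∈ S, ∀ e ∈ S, ¬ Crosses d e) →
      ((∀ d ∈ moveSegment δ '' S, IsDiagonal d) ∧
        ∀ d ∈ moveSegment δ '' S, ∀ e ∈ moveSegment δ '' S, ¬ Crosses d e) := by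
    rintro δ S ⟨h1, h2⟩
    refine ⟨?_, ?_⟩
    · rintro _ ⟨d, hd, rfl⟩
      exact (h1 d hd).move δ
    · rintro _ ⟨d, hd, rfl⟩ _ ⟨e, he, rfl⟩ hc
      exact h2 d hd e he (by simpa [moveSegment_inv] using hc.move δ⁻¹)
  refine ⟨aux γ T h.1, fun S hS hTS => ?_⟩
  have h3 : moveSegment γ⁻¹ '' S ⊆ T := by
    refine h.2 (aux γ⁻¹ S hS) fun d hd => ?_
    exact ⟨moveSegment γ d, hTS ⟨d, hd, rfl⟩, moveSegment_inv γ d⟩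
  intro e he
  refine ⟨moveSegment γ⁻¹ e, h3 ⟨e, he, rfl⟩, ?_⟩
  simpa using moveSegment_inv γ⁻¹ e

/-- The colored triangulation obtained from `t` by replacing each color `c` by `σ c`. -/
def ColoredTriangulation.recolor {n : ℕ} (σ : Equiv.Perm (Fin n)) (t : ColoredTriangulation n) :
    ColoredTriangulation n where
  diag c := t.diag (σ⁻¹ c)
  injective := t.injective.comp (σ⁻¹).injective
  isTriangulation := by
    have h : Set.range (fun c => t.diag (σ⁻¹ c)) = Set.range t.diag :=
      (σ⁻¹).surjective.range_comp t.diag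
    rw [h]
    exact t.isTriangulation

/-- The image of the colored triangulation `t` under the symmetry `γ` of the polygon, the colors
of the diagonals being preserved. -/
def ColoredTriangulation.move {n : ℕ} (γ : DihedralGroup (n + 3)) (t : ColoredTriangulation n) :
    ColoredTriangulation n where
  diag c := moveSegment γ (t.diag c)
  injective := (moveSegment_injective γ).comp t.injective
  isTriangulation := by
    have h : Set.range (fun c => moveSegment γ (t.diag c)) = moveSegment γ '' Set.range t.diag :=
      Set.range_comp (moveSegment γ) t.diag
    rw [h]
    exact t.isTriangulation.move γ

end ColAssoc

open ColAssoc

/-! The atoms of the face poset are the singletons `face ∅ t`, so an order automorphism is induced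
by a permutation `f` of the colored triangulations that maps faces to faces
(`exists_perm_of_orderIso`). Looking at faces with one color, `f` carries the flip of color `c` at
`t` to a flip of some color `σ t c`. Looking at faces with two colors, `σ t` does not change when
`t` is flipped. As the exchange graph is connected, `σ` is a single permutation of the colors
(`exists_perm_colors`), and undoing it leaves a bijection `g` that commutes with every flip.

Such a `g` is a symmetry of the polygon (`exists_eq_move`). Two diagonals lie in a common triangle
exactly when their flips do not commute (`adjacent_iff`), so `g` preserves adjacency, both in `fan
n` and in its flips. This information forces `g (fan n)` to be the image of the fan under some `γ`
in the dihedral group (`exists_eq_fan_move`), and connectedness extends `g t = t.move γ` to all `t`.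

Connectedness (`fan_reachable`) has two ingredients: every triangulation can be flipped towards the
vertex `0` until it is a recolored fan, and five flips in a pentagon exchange two colors, so that
neighboring transpositions give all recolorings of the fan. Injectivity of the action follows since
a pair acting trivially preserves the fan at each vertex, hence fixes the vertex. -/

namespace ColAssoc

variable {n : ℕ}

/-! ### Cyclic order and crossing segments -/

theorem sbtw_rebase (o a b c : Vertex n) :
    sbtw a b c ↔ sbtw (a - o) (b - o) (c - o) := by
  constructor
  · intro h
    simpa [sub_eq_add_neg] using sbtw_add (-o) h
  · intro h
    simpa using sbtw_add o h

/-- Rotation invariance lets the vertices be numbered from any base point `o`; with a good choice of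
`o`, questions about cyclic order become linear arithmetic. -/
theorem sbtw_iff_val_sub (o a b c : Vertex n) : sbtw a b c ↔
    (a - o).val < (b - o).val ∧ (b - o).val < (c - o).val ∨
    (b - o).val < (c - o).val ∧ (c - o).val < (a - o).val ∨
      (c - o).val < (a - o).val ∧ (a - o).val < (b - o).val := by
  rw [sbtw_rebase o, sbtw_iff_val]

theorem val_sub_self (o : Vertex n) : (o - o).val = 0 := by simp

theorem val_sub_inj {o a b : Vertex n} : (a - o).val = (b - o).val ↔ a = b := by
  rw [(ZMod.val_injective (n + 3)).eq_iff]; simp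

theorem sbtw_ne {a b c : Vertex n} (h : sbtw a b c) : a ≠ b ∧ b ≠ c ∧ c ≠ a := by
  rw [sbtw_iff_val] at h
  refine ⟨?_, ?_, ?_⟩ <;> rintro rfl <;> omega

theorem sbtw_of_ne {a b c : Vertex n} (h1 : a ≠ b) (h2 : b ≠ c) (h3 : c ≠ a) :
    sbtw a b c ∨ sbtw c b a := by
  rw [sbtw_iff_val, sbtw_iff_val]
  have h1 := (ZMod.val_injective (n + 3)).ne h1
  have h2 := (ZMod.val_injective (n + 3)).ne h2
  have h3 := (ZMod.val_injective (n + 3)).ne h3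
  omega

theorem val_one_vertex : (1 : Vertex n).val = 1 :=
  ZMod.val_one'' (by omega)

theorem not_sbtw_succ (i x : Vertex n) : ¬ sbtw i x (i + 1) := by
  rw [sbtw_iff_val_sub i, val_sub_self, add_sub_cancel_left, val_one_vertex]
  omega

theorem sbtw_succ {a x b : Vertex n} (h : sbtw a x b) : sbtw a (a + 1) b := by
  rw [sbtw_iff_val_sub a, val_sub_self] at h ⊢
  rw [add_sub_cancel_left, val_one_vertex]
  omega

theorem Crosses.symm {d e : Sym2 (Vertex n)} (h : Crosses d e) : Crosses e d := by
  obtain ⟨a, b, a', b', h1, h2, h3, h4⟩ := h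
  refine ⟨b, a', b', a, h2, h1.trans Sym2.eq_swap, ?_, ?_⟩ <;>
  · rw [sbtw_iff_val] at h3 h4 ⊢
    omega

theorem crosses_mk {p q r s : Vertex n} : Crosses s(p, q) s(r, s) ↔
    (sbtw p r q ∧ sbtw q s p) ∨ (sbtw p s q ∧ sbtw q r p) := by
  constructor
  · rintro ⟨a, b, a', b', h1, h2, h3, h4⟩
    rw [Sym2.eq_iff] at h1 h2
    rcases h1 with ⟨rfl, rfl⟩ | ⟨rfl, rfl⟩ <;> rcases h2 with ⟨rfl, rfl⟩ | ⟨rfl, rfl⟩ <;> tauto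
  · rintro (⟨h1, h2⟩ | ⟨h1, h2⟩)
    · exact ⟨p, r, q, s, rfl, rfl, h1, h2⟩
    · exact ⟨p, s, q, r, rfl, Sym2.eq_swap, h1, h2⟩

theorem crosses_of_lt (o : Vertex n) {p q r s : Vertex n} (h1 : (p - o).val < (r - o).val)
    (h2 : (r - o).val < (q - o).val) (h3 : (q - o).val < (s - o).val) :
    Crosses s(p, q) s(r, s) := by
  rw [crosses_mk, sbtw_iff_val_sub o, sbtw_iff_val_sub o q s p]
  omega

theorem sbtw_iff_left {o x y : Vertex n} :
    sbtw o x y ↔ 0 < (x - o).val ∧ (x - o).val < (y - o).val := by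
  rw [sbtw_iff_val_sub o, val_sub_self]
  omega

theorem sbtw_iff_right {o x y : Vertex n} :
    sbtw y x o ↔ 0 < (y - o).val ∧ (y - o).val < (x - o).val := by
  rw [sbtw_iff_val_sub o, val_sub_self]
  omega

theorem sbtw_iff_of_lt (o : Vertex n) {x y z : Vertex n} (h : (x - o).val < (z - o).val) :
    sbtw x y z ↔ (x - o).val < (y - o).val ∧ (y - o).val < (z - o).val := by
  rw [sbtw_iff_val_sub o]
  omega

theorem sbtw_iff_of_gt (o : Vertex n) {x y z : Vertex n} (h : (z - o).val < (x - o).val) :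
    sbtw x y z ↔ (x - o).val < (y - o).val ∨ (y - o).val < (z - o).val := by
  rw [sbtw_iff_val_sub o]
  omega

theorem not_crosses_self (e : Sym2 (Vertex n)) : ¬ Crosses e e := by
  induction e with | _ a b =>
  rw [crosses_mk]
  rintro (⟨h, -⟩ | ⟨h, -⟩) <;> have := sbtw_ne h <;> tauto

theorem IsSide.not_crosses {e d : Sym2 (Vertex n)} (h : IsSide e) : ¬ Crosses e d := by
  obtain ⟨i, rfl⟩ := h
  induction d with | _ a b =>
  rw [crosses_mk]
  rintro (⟨h, -⟩ | ⟨h, -⟩) <;> exact not_sbtw_succ _ _ h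

theorem IsSide.not_isDiag {e : Sym2 (Vertex n)} (h : IsSide e) : ¬ e.IsDiag := by
  obtain ⟨i, rfl⟩ := h
  rw [Sym2.mk_isDiag_iff]
  intro h
  have := congrArg ZMod.val (left_eq_add.mp h)
  rw [val_one_vertex] at this
  simp at this

theorem isDiagonal_of_sbtw {a b a' b' : Vertex n} (h1 : sbtw a b a') (h2 : sbtw a' b' a) :
    IsDiagonal s(a, a') := by
  refine ⟨fun h => (sbtw_ne h1).2.2 h.symm, ?_⟩
  intro h
  exact h.not_crosses (crosses_mk.2 (Or.inl ⟨h1, h2⟩))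

theorem side_or_sbtw {a b : Vertex n} (h : a ≠ b) : b = a + 1 ∨ ∃ x, sbtw a x b := by
  by_contra! hc
  refine (hc.2 (a + 1)) ?_
  rw [sbtw_iff_val_sub a, val_sub_self, add_sub_cancel_left, val_one_vertex]
  have h1 : (b - a).val ≠ (a - a).val := fun h' => h (val_sub_inj.1 h').symm
  have h2 : (b - a).val ≠ (a + 1 - a).val := fun h' => hc.1 (val_sub_inj.1 h')
  rw [val_sub_self] at h1
  rw [add_sub_cancel_left, val_one_vertex] at h2
  omega

theorem IsDiagonal.exists_sbtw {a b : Vertex n} (h : IsDiagonal s(a, b)) : ∃ x, sbtw a x b := by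
  rcases side_or_sbtw (fun hab => h.1 hab) with h' | h'
  · exact absurd ⟨a, by rw [← h']⟩ h.2
  · exact h'

/-! ### Triangles and quadrilaterals of a triangulation; existence of flips -/

namespace ColoredTriangulation

variable {t : ColoredTriangulation n}

theorem isDiagonal (t : ColoredTriangulation n) (c : Fin n) : IsDiagonal (t.diag c) :=
  t.isTriangulation.1.1 _ ⟨c, rfl⟩

theorem hasEdge_diag (t : ColoredTriangulation n) (c : Fin n) : t.HasEdge (t.diag c) :=
  Or.inr ⟨c, rfl⟩

theorem hasEdge_of_diag_eq {c : Fin n} {e : Sym2 (Vertex n)} (h : t.diag c = e) : t.HasEdge e :=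
  h ▸ t.hasEdge_diag c

theorem HasEdge.swap {a b : Vertex n} (h : t.HasEdge s(a, b)) : t.HasEdge s(b, a) := by
  rwa [Sym2.eq_swap]

theorem HasEdge.ne {a b : Vertex n} (h : t.HasEdge s(a, b)) : a ≠ b := by
  intro hab
  refine absurd (Sym2.mk_isDiag_iff.2 hab) ?_
  rcases h with h | ⟨c, h⟩
  · exact h.not_isDiag
  · exact h ▸ (t.isDiagonal c).1

theorem HasEdge.not_crosses {d e : Sym2 (Vertex n)} (hd : t.HasEdge d) (he : t.HasEdge e) :
    ¬ Crosses d e := by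
  rcases hd with hd | hd
  · exact hd.not_crosses
  rcases he with he | he
  · exact fun h => he.not_crosses h.symm
  · exact t.isTriangulation.1.2 d hd e he

/-- Otherwise `e` could be added to the diagonals, against maximality. -/
theorem exists_crosses {e : Sym2 (Vertex n)} (he : ¬ e.IsDiag) (h : ¬ t.HasEdge e) :
    ∃ c, Crosses e (t.diag c) := by
  by_contra! hc
  apply h
  right
  refine t.isTriangulation.2 (y := insert e (Set.range t.diag)) ⟨?_, ?_⟩
    (Set.subset_insert _ _) (Set.mem_insert _ _)
  · rintro d (rfl | ⟨c, rfl⟩)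
    · exact ⟨he, fun hs => h (Or.inl hs)⟩
    · exact t.isDiagonal c
  · rintro d (rfl | ⟨c, rfl⟩) d' (rfl | ⟨c', rfl⟩)
    · exact not_crosses_self _
    · exact hc c'
    · exact fun hx => hc c hx.symm
    · exact (t.hasEdge_diag c).not_crosses (t.hasEdge_diag c')

theorem HasEdge.exists_third {a b y : Vertex n} (h : t.HasEdge s(a, b)) (hy : sbtw a y b) :
    ∃ x, sbtw a x b ∧ t.HasEdge s(a, x) ∧ t.HasEdge s(x, b) := by
  -- The apex is the last vertex before `b` that is joined to `a`; the side from `a` to `a + 1`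
  -- shows that there is one.
  obtain ⟨x, ⟨hx1, hx2⟩, hx⟩ := Set.exists_max_image {x | sbtw a x b ∧ t.HasEdge s(a, x)}
    (fun x => (x - a).val) (Set.toFinite _) ⟨a + 1, sbtw_succ hy, Or.inl ⟨a, rfl⟩⟩
  refine ⟨x, hx1, hx2, ?_⟩
  by_contra hne
  obtain ⟨c, hc⟩ := exists_crosses (e := s(x, b)) (fun h => (sbtw_ne hx1).2.1 h) hne
  -- An edge crossing `x b` starts at `p` between `x` and `b`. Its other end `q` lies beyond `b`, so
  -- that it crosses `a b`, or is `a`, against the choice of `x`, or lies between `a` and `x`, so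
  -- that it crosses `a x`.
  have key : ∀ p q, t.HasEdge s(p, q) → sbtw x p b → sbtw b q x → False := by
    intro p q hpq h1 h2
    have hx1 := sbtw_iff_left.1 hx1
    rw [sbtw_iff_of_lt a hx1.2] at h1
    rw [sbtw_iff_of_gt a hx1.2] at h2
    rcases h2 with h2 | h2
    · exact h.not_crosses hpq (crosses_of_lt a (by rw [val_sub_self]; omega) h1.2 h2)
    · by_cases hq : q = a
      · subst hq
        have := hx p ⟨sbtw_iff_left.2 ⟨by omega, h1.2⟩, hpq.swap⟩
        omega
      · have hq : (q - a).val ≠ (a - a).val := fun h' => hq (val_sub_inj.1 h')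
        rw [val_sub_self] at hq
        exact hx2.not_crosses hpq.swap
          (crosses_of_lt a (by rw [val_sub_self]; omega) h2 h1.1)
  have he := t.hasEdge_diag c
  generalize t.diag c = e at hc he
  induction e with | _ p q =>
  rcases crosses_mk.1 hc with ⟨h1, h2⟩ | ⟨h1, h2⟩
  · exact key _ _ he h1 h2
  · exact key _ _ he.swap h1 h2

theorem HasEdge.third_unique {a b x y : Vertex n} (hx : sbtw a x b) (hy : sbtw a y b)
    (h1 : t.HasEdge s(a, x)) (h2 : t.HasEdge s(x, b)) (h3 : t.HasEdge s(a, y))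
    (h4 : t.HasEdge s(y, b)) : x = y := by
  rw [sbtw_iff_left] at hx hy
  rcases lt_trichotomy (x - a).val (y - a).val with h | h | h
  · exact absurd (crosses_of_lt a (by rw [val_sub_self]; omega) h hy.2) (h3.not_crosses h2)
  · exact val_sub_inj.1 h
  · exact absurd (crosses_of_lt a (by rw [val_sub_self]; omega) h hx.2) (h1.not_crosses h4)

/-- The segments `a b`, `b a'`, `a' b'`, `b' a` are edges of the triangulation, forming a
quadrilateral with the diagonal `a a'` of color `c`. -/
structure Quad (t : ColoredTriangulation n) (c : Fin n) (a b a' b' : Vertex n) : Prop where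
  diag : t.diag c = s(a, a')
  ne : b ≠ b'
  e1 : t.HasEdge s(a, b)
  e2 : t.HasEdge s(b, a')
  e3 : t.HasEdge s(a', b')
  e4 : t.HasEdge s(b', a)

theorem Quad.swap {c : Fin n} {a b a' b' : Vertex n} (h : t.Quad c a b a' b') :
    t.Quad c a' b a b' :=
  ⟨h.diag.trans Sym2.eq_swap, h.ne, h.e2.swap, h.e1.swap, h.e4.swap, h.e3.swap⟩

theorem Quad.rotate {c : Fin n} {a b a' b' : Vertex n} (h : t.Quad c a b a' b') :
    t.Quad c a' b' a b :=
  ⟨h.diag.trans Sym2.eq_swap, h.ne.symm, h.e3, h.e4, h.e1, h.e2⟩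

/-- `Quad` records no orientation, only `b ≠ b'`. This suffices, since two apexes on the same side
of `a a'` coincide by `HasEdge.third_unique`. -/
theorem Quad.sbtw {c : Fin n} {a b a' b' : Vertex n} (h : t.Quad c a b a' b') :
    sbtw a b a' ∧ sbtw a' b' a ∨ sbtw a' b a ∧ sbtw a b' a' := by
  have hn : a ≠ a' := (hasEdge_of_diag_eq h.diag).ne
  have h1 := sbtw_of_ne h.e1.ne h.e2.ne hn.symm
  have h2 := sbtw_of_ne h.e3.ne h.e4.ne hn
  rcases h1 with h1 | h1 <;> rcases h2 with h2 | h2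
  · exact Or.inl ⟨h1, h2⟩
  · exact absurd (HasEdge.third_unique h1 h2 h.e1 h.e2 h.e4.swap h.e3.swap) h.ne
  · exact absurd (HasEdge.third_unique h1 h2 h.e2.swap h.e1.swap h.e3 h.e4) h.ne
  · exact Or.inr ⟨h1, h2⟩

theorem Quad.crosses {c : Fin n} {a b a' b' : Vertex n} (h : t.Quad c a b a' b') :
    Crosses s(a, a') s(b, b') := by
  rw [crosses_mk]
  rcases h.sbtw with h | h <;> tauto

theorem Quad.not_hasEdge {c : Fin n} {a b a' b' : Vertex n} (h : t.Quad c a b a' b') :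
    ¬ t.HasEdge s(b, b') :=
  fun hb => (hasEdge_of_diag_eq h.diag).not_crosses hb h.crosses

theorem Quad.third {c : Fin n} {a b a' b' x : Vertex n} (h : t.Quad c a b a' b')
    (h1 : t.HasEdge s(a, x)) (h2 : t.HasEdge s(x, a')) : x = b ∨ x = b' := by
  have hn : a ≠ a' := (hasEdge_of_diag_eq h.diag).ne
  have hx := sbtw_of_ne h1.ne h2.ne hn.symm
  rcases h.sbtw with ⟨hb, hb'⟩ | ⟨hb, hb'⟩ <;> rcases hx with hx | hx
  · exact Or.inl (HasEdge.third_unique hx hb h1 h2 h.e1 h.e2)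
  · exact Or.inr (HasEdge.third_unique hx hb' h2.swap h1.swap h.e3 h.e4)
  · exact Or.inr (HasEdge.third_unique hx hb' h1 h2 h.e4.swap h.e3.swap)
  · exact Or.inl (HasEdge.third_unique hx hb h2.swap h1.swap h.e2.swap h.e1.swap)

theorem exists_quad (t : ColoredTriangulation n) (c : Fin n) :
    ∃ a b a' b', t.Quad c a b a' b' ∧ SBtw.sbtw a b a' ∧ SBtw.sbtw a' b' a := by
  have hd := t.isDiagonal c
  have he := t.hasEdge_diag c
  generalize hx : t.diag c = e at *
  induction e with | _ a a' =>
  obtain ⟨y, hy⟩ := hd.exists_sbtw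
  obtain ⟨z, hz⟩ := (show IsDiagonal s(a', a) by rwa [Sym2.eq_swap]).exists_sbtw
  obtain ⟨b, hb, e1, e2⟩ := he.exists_third hy
  obtain ⟨b', hb', e3, e4⟩ := he.swap.exists_third hz
  refine ⟨a, b, a', b', ⟨hx, ?_, e1, e2, e3, e4⟩, hb, hb'⟩
  rintro rfl
  rw [sbtw_iff_val] at hb hb'
  omega

theorem exists_quad_of_third {c : Fin n} {a a' x : Vertex n} (hc : t.diag c = s(a, a'))
    (h1 : t.HasEdge s(a, x)) (h2 : t.HasEdge s(x, a')) : ∃ y, t.Quad c a x a' y := by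
  have key : ∃ b b', t.Quad c a b a' b' := by
    obtain ⟨p, b, p', b', h, -⟩ := t.exists_quad c
    have := hc.symm.trans h.diag
    rcases Sym2.eq_iff.1 this with ⟨rfl, rfl⟩ | ⟨rfl, rfl⟩
    · exact ⟨b, b', h⟩
    · exact ⟨b, b', h.swap⟩
  obtain ⟨b, b', h⟩ := key
  rcases h.third h1 h2 with rfl | rfl
  · exact ⟨b', h⟩
  · exact ⟨b, h.rotate.swap⟩

theorem exists_isFlip (t : ColoredTriangulation n) (c : Fin n) : ∃ t', IsFlip c t t' := by
  obtain ⟨a, b, a', b', h, hb, hb'⟩ := t.exists_quad c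
  have v1 := sbtw_iff_left.1 hb
  have v2 := sbtw_iff_right.1 hb'
  have v0 := val_sub_self a
  have hb1 : sbtw b a' b' := by rw [sbtw_iff_val] at *; omega
  have hb2 : sbtw b' a b := by rw [sbtw_iff_val] at *; omega
  have hnb : ∀ k, t.diag k ≠ s(b, b') := fun k hk => h.not_hasEdge (hasEdge_of_diag_eq hk)
  -- A diagonal of `t` that crosses `b b'` cannot cross the four sides of the quadrilateral, so its
  -- ends are `a` and `a'`.
  have hcr : ∀ k, Crosses s(b, b') (t.diag k) → k = c := by
    intro k hk
    apply t.injective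
    rw [h.diag]
    have he := t.hasEdge_diag k
    generalize t.diag k = e at hk he
    have key : ∀ p q, t.HasEdge s(p, q) → sbtw b p b' → sbtw b' q b → s(p, q) = s(a, a') := by
      intro p q he h1 h2
      rw [sbtw_iff_of_lt a (v1.2.trans v2.2)] at h1
      rw [sbtw_iff_of_gt a (v1.2.trans v2.2)] at h2
      have hp : p = a' := by
        rw [← val_sub_inj (o := a)]
        rcases lt_trichotomy (p - a).val (a' - a).val with h3 | h3 | h3
        · rcases h2 with h2 | h2
          · exact absurd (crosses_of_lt a h1.1 h3 (v2.2.trans h2)) (h.e2.not_crosses he)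
          · exact absurd (crosses_of_lt a h2 h1.1 h3) (he.swap.not_crosses h.e2)
        · exact h3
        · rcases h2 with h2 | h2
          · exact absurd (crosses_of_lt a h3 h1.2 h2) (h.e3.not_crosses he)
          · exact absurd (crosses_of_lt a (h2.trans v1.2) h3 h1.2) (he.swap.not_crosses h.e3)
      have hq : q = a := by
        by_contra hq
        rw [← val_sub_inj (o := a)] at hq
        rcases h2 with h2 | h2
        · exact absurd (crosses_of_lt a (by omega) h1.2 h2) (h.e4.swap.not_crosses he)
        · exact absurd (crosses_of_lt a (by omega) h2 h1.1) (h.e1.not_crosses he.swap)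
      rw [hp, hq, Sym2.eq_swap]
    induction e with | _ p q =>
    rcases crosses_mk.1 hk with ⟨h1, h2⟩ | ⟨h1, h2⟩
    · exact key _ _ he h1 h2
    · rw [Sym2.eq_swap]; exact key _ _ he.swap h1 h2
  have hu : ∀ k, k ≠ c → Function.update t.diag c s(b, b') k = t.diag k := fun k hk =>
    Function.update_of_ne hk _ _
  have huc : Function.update t.diag c s(b, b') c = s(b, b') := Function.update_self _ _ _
  refine ⟨⟨Function.update t.diag c s(b, b'), ?_, ⟨⟨?_, ?_⟩, ?_⟩⟩,
    a, b, a', b', h.diag, huc, hb, hb', h.e1, h.e2, h.e3, h.e4, hu⟩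
  · intro k l hkl
    by_cases hk : k = c <;> by_cases hl : l = c
    · rw [hk, hl]
    · subst hk
      rw [huc, hu l hl] at hkl
      exact absurd hkl.symm (hnb l)
    · subst hl
      rw [huc, hu k hk] at hkl
      exact absurd hkl (hnb k)
    · rw [hu k hk, hu l hl] at hkl
      exact t.injective hkl
  · rintro _ ⟨k, rfl⟩
    by_cases hk : k = c
    · subst hk
      rw [huc]
      exact isDiagonal_of_sbtw hb1 hb2
    · rw [hu k hk]
      exact t.isDiagonal k
  · rintro _ ⟨k, rfl⟩ _ ⟨l, rfl⟩
    by_cases hk : k = c <;> by_cases hl : l = c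
    · rw [hk, hl]
      exact not_crosses_self _
    · subst hk
      rw [huc, hu l hl]
      exact fun hx => hl (hcr l hx)
    · subst hl
      rw [huc, hu k hk]
      exact fun hx => hk (hcr k hx.symm)
    · rw [hu k hk, hu l hl]
      exact (t.hasEdge_diag k).not_crosses (t.hasEdge_diag l)
  -- Maximality: a compatible diagonal `e` in `t` is not `a a'`, which crosses `b b'`, so it was
  -- kept. If `e` is not in `t`, it crosses a diagonal of `t`, necessarily `a a'`, but no side of
  -- the quadrilateral, so it is `b b'`.
  · rintro S ⟨hS1, hS2⟩ hTS e he
    have hS : ∀ k, k ≠ c → ¬ Crosses e (t.diag k) := fun k hk =>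
      hS2 e he _ (hTS ⟨k, hu k hk⟩)
    have hSc : ¬ Crosses e s(b, b') := hS2 e he _ (hTS ⟨c, huc⟩)
    have hS' : ∀ d, t.HasEdge d → d ≠ s(a, a') → ¬ Crosses e d := by
      rintro d (hd | ⟨k, rfl⟩) hne
      · exact fun hx => hd.not_crosses hx.symm
      · exact hS k (by rintro rfl; exact hne h.diag)
    by_cases heT : t.HasEdge e
    · rcases heT with heT | ⟨k, rfl⟩
      · exact absurd heT (hS1 e he).2
      · refine ⟨k, hu k ?_⟩
        rintro rfl
        rw [h.diag] at hSc
        exact hSc h.crosses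
    · obtain ⟨k, hk⟩ := exists_crosses (hS1 e he).1 heT
      have hkc : k = c := by
        by_contra hkc
        exact hS k hkc hk
      rw [hkc, h.diag] at hk
      refine ⟨c, huc.trans ?_⟩
      have key : ∀ p q, (∀ d, t.HasEdge d → d ≠ s(a, a') → ¬ Crosses s(p, q) d) →
          sbtw a p a' → sbtw a' q a → s(b, b') = s(p, q) := by
        intro p q hpq h1 h2
        have l1 := h.e1.ne
        have l2 := h.e2.ne
        have l3 := h.e3.ne
        have l4 := h.e4.ne
        have m1 := hpq _ h.e1 (by rw [Ne, Sym2.eq_iff]; grind)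
        have m2 := hpq _ h.e2 (by rw [Ne, Sym2.eq_iff]; grind)
        have m3 := hpq _ h.e3 (by rw [Ne, Sym2.eq_iff]; grind)
        have m4 := hpq _ h.e4 (by rw [Ne, Sym2.eq_iff]; grind)
        rw [sbtw_iff_left] at h1
        rw [sbtw_iff_right] at h2
        have hp : p = b := by
          rw [← val_sub_inj (o := a)]
          rcases lt_trichotomy (p - a).val (b - a).val with h3 | h3 | h3
          · exact absurd (crosses_of_lt a (by omega) h3 (v1.2.trans h2.2)).symm m1
          · exact h3
          · exact absurd (crosses_of_lt a h3 h1.2 h2.2).symm m2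
        have hq : q = b' := by
          rw [← val_sub_inj (o := a)]
          rcases lt_trichotomy (q - a).val (b' - a).val with h3 | h3 | h3
          · exact absurd (crosses_of_lt a h1.2 h2.2 h3) m3
          · exact h3
          · rw [Sym2.eq_swap (a := b')] at m4
            exact absurd (crosses_of_lt a (by omega) (h1.2.trans v2.2) h3).symm m4
        rw [hp, hq]
      induction e with | _ p q =>
      rcases crosses_mk.1 hk.symm with ⟨h1, h2⟩ | ⟨h1, h2⟩
      · exact key _ _ hS' h1 h2
      · rw [Sym2.eq_swap (a := p)] at hS' ⊢
        exact key _ _ hS' h1 h2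

end ColoredTriangulation

/-! ### The flip as a function -/

namespace ColoredTriangulation

variable {t : ColoredTriangulation n}

/-- The colored triangulation obtained by flipping the diagonal of color `c`. -/
noncomputable def flip (t : ColoredTriangulation n) (c : Fin n) : ColoredTriangulation n :=
  (t.exists_isFlip c).choose

theorem isFlip_flip (t : ColoredTriangulation n) (c : Fin n) : IsFlip c t (t.flip c) :=
  (t.exists_isFlip c).choose_spec

/-- Flips are unique because a diagonal determines the quadrilateral around it, by `Quad.third`. -/
theorem Quad.diag_of_isFlip {t' : ColoredTriangulation n} {c : Fin n} {a b a' b' : Vertex n}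
    (h : t.Quad c a b a' b') (hf : IsFlip c t t') : t'.diag c = s(b, b') := by
  obtain ⟨p, q, p', q', h1, h2, h3, h4, e1, e2, e3, e4, -⟩ := hf
  have hq : t.Quad c p q p' q' := by
    refine ⟨h1, ?_, e1, e2, e3, e4⟩
    rintro rfl
    rw [sbtw_iff_val] at h3 h4
    omega
  have key : ∀ x y x' y', t.Quad c x y x' y' → x = a → x' = a' → s(y, y') = s(b, b') := by
    rintro x y x' y' hx rfl rfl
    have := hx.ne
    rw [Sym2.eq_iff]
    rcases h.third hx.e1 hx.e2 with rfl | rfl <;>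
      rcases h.third hx.e4.swap hx.e3.swap with rfl | rfl <;> tauto
  rw [h2]
  rcases Sym2.eq_iff.1 (h1.symm.trans h.diag) with ⟨h5, h6⟩ | ⟨h5, h6⟩
  · exact key _ _ _ _ hq h5 h6
  · exact key _ _ _ _ hq.swap h6 h5

theorem Quad.flip_diag {c : Fin n} {a b a' b' : Vertex n}
    (h : t.Quad c a b a' b') : (t.flip c).diag c = s(b, b') :=
  h.diag_of_isFlip (t.isFlip_flip c)

theorem flip_diag_of_ne (t : ColoredTriangulation n) {c k : Fin n} (h : k ≠ c) :
    (t.flip c).diag k = t.diag k := by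
  obtain ⟨_, _, _, _, -, -, -, -, -, -, -, -, hf⟩ := t.isFlip_flip c
  exact hf k h

theorem ext_of_ne {t t' : ColoredTriangulation n} (c : Fin n) (hc : t.diag c = t'.diag c)
    (h : ∀ k, k ≠ c → t.diag k = t'.diag k) : t = t' := by
  ext1
  funext k
  by_cases hk : k = c
  · rw [hk, hc]
  · exact h k hk

theorem isFlip_iff {t' : ColoredTriangulation n} {c : Fin n} :
    IsFlip c t t' ↔ t' = t.flip c := by
  constructor
  · intro h
    obtain ⟨a, b, a', b', hq, -⟩ := t.exists_quad c
    refine ext_of_ne c ((hq.diag_of_isFlip h).trans hq.flip_diag.symm) fun k hk => ?_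
    obtain ⟨_, _, _, _, -, -, -, -, -, -, -, -, hf⟩ := h
    rw [hf k hk, t.flip_diag_of_ne hk]
  · rintro rfl
    exact t.isFlip_flip c

@[simp]
theorem flip_flip (t : ColoredTriangulation n) (c : Fin n) : (t.flip c).flip c = t :=
  (isFlip_iff.1 (t.isFlip_flip c).symm).symm

theorem flip_ne (t : ColoredTriangulation n) (c : Fin n) : t.flip c ≠ t :=
  (t.isFlip_flip c).ne.symm

theorem flip_diag_ne (t : ColoredTriangulation n) (c : Fin n) :
    (t.flip c).diag c ≠ t.diag c := fun h =>
  t.flip_ne c (ext_of_ne c h fun _ hk => t.flip_diag_of_ne hk)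

theorem flip_injective (t : ColoredTriangulation n) : Function.Injective t.flip := by
  intro c d h
  by_contra hcd
  apply t.flip_diag_ne c
  rw [h, t.flip_diag_of_ne hcd]

theorem HasEdge.flip {c : Fin n} {e : Sym2 (Vertex n)} (he : t.HasEdge e) (h : t.diag c ≠ e) :
    (t.flip c).HasEdge e :=
  HasEdge.of_flip (fun _ hk => t.flip_diag_of_ne hk) he h.symm

/-! ### Compatibility of flips with the symmetries -/

@[simp]
theorem recolor_diag (σ : Equiv.Perm (Fin n)) (t : ColoredTriangulation n) (c : Fin n) :
    (t.recolor σ).diag c = t.diag (σ⁻¹ c) := rfl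

@[simp]
theorem move_diag (γ : DihedralGroup (n + 3)) (t : ColoredTriangulation n) (c : Fin n) :
    (t.move γ).diag c = moveSegment γ (t.diag c) := rfl

theorem HasEdge.recolor {e : Sym2 (Vertex n)} (σ : Equiv.Perm (Fin n)) (h : t.HasEdge e) :
    (t.recolor σ).HasEdge e := by
  rcases h with h | ⟨c, rfl⟩
  · exact Or.inl h
  · exact hasEdge_of_diag_eq (c := σ c) (by simp)

theorem HasEdge.move {a b : Vertex n} (γ : DihedralGroup (n + 3)) (h : t.HasEdge s(a, b)) :
    (t.move γ).HasEdge s(polygonSymm n γ a, polygonSymm n γ b) := by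
  rw [← moveSegment_mk]
  rcases h with h | ⟨c, h⟩
  · exact Or.inl (h.move γ)
  · exact hasEdge_of_diag_eq (c := c) (by rw [move_diag, h])

theorem recolor_flip (σ : Equiv.Perm (Fin n)) (t : ColoredTriangulation n) (c : Fin n) :
    (t.flip c).recolor σ = (t.recolor σ).flip (σ c) := by
  obtain ⟨a, b, a', b', h, -⟩ := t.exists_quad c
  have h' : (t.recolor σ).Quad (σ c) a b a' b' := ⟨by simp [h.diag], h.ne, h.e1.recolor σ,
    h.e2.recolor σ, h.e3.recolor σ, h.e4.recolor σ⟩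
  refine ext_of_ne (σ c) ?_ fun k hk => ?_
  · rw [h'.flip_diag, recolor_diag, ← h.flip_diag]
    simp
  · rw [flip_diag_of_ne _ hk, recolor_diag, recolor_diag, flip_diag_of_ne]
    rintro rfl
    simp at hk

theorem move_flip (γ : DihedralGroup (n + 3)) (t : ColoredTriangulation n) (c : Fin n) :
    (t.flip c).move γ = (t.move γ).flip c := by
  obtain ⟨a, b, a', b', h, -⟩ := t.exists_quad c
  have h' : (t.move γ).Quad c (polygonSymm n γ a) (polygonSymm n γ b) (polygonSymm n γ a')
      (polygonSymm n γ b') := ⟨by rw [move_diag, h.diag, moveSegment_mk],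
    (polygonSymm n γ).injective.ne h.ne, h.e1.move γ, h.e2.move γ, h.e3.move γ, h.e4.move γ⟩
  refine ext_of_ne c ?_ fun k hk => ?_
  · rw [h'.flip_diag, move_diag, h.flip_diag, moveSegment_mk]
  · rw [flip_diag_of_ne _ hk, move_diag, move_diag, flip_diag_of_ne _ hk]

/-! ### Adjacent diagonals -/

/-- The diagonals of colors `c` and `d` are sides of a common triangle. -/
def Adjacent (t : ColoredTriangulation n) (c d : Fin n) : Prop :=
  ∃ v a b, t.diag c = s(v, a) ∧ t.diag d = s(v, b) ∧ t.HasEdge s(a, b)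

theorem Adjacent.symm {c d : Fin n} (h : t.Adjacent c d) : t.Adjacent d c := by
  obtain ⟨v, a, b, h1, h2, h3⟩ := h
  exact ⟨v, b, a, h2, h1, h3.swap⟩

theorem Quad.adjacent {c d : Fin n} {a b a' b' : Vertex n} (h : t.Quad c a b a' b')
    (hd : t.diag d = s(a, b)) : t.Adjacent c d :=
  ⟨a, a', b, h.diag, hd, h.e2.swap⟩

/-- The diagonal of color `d` is not a side of the quadrilateral around that of color `c`, so this
quadrilateral survives the flip of `d`; and vice versa. -/
theorem flip_comm_of_not_adjacent {c d : Fin n} (hcd : c ≠ d) (h : ¬ t.Adjacent c d) :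
    (t.flip c).flip d = (t.flip d).flip c := by
  have key : ∀ c d : Fin n, c ≠ d → ¬ t.Adjacent c d →
      ((t.flip d).flip c).diag c = (t.flip c).diag c := by
    intro c d hcd h
    obtain ⟨a, b, a', b', hq, -⟩ := t.exists_quad c
    have hq' : (t.flip d).Quad c a b a' b' := by
      refine ⟨(t.flip_diag_of_ne hcd).trans hq.diag, hq.ne, hq.e1.flip ?_, hq.e2.flip ?_,
        hq.e3.flip ?_, hq.e4.flip ?_⟩
      · exact fun hd => h (hq.adjacent hd)
      · exact fun hd => h (hq.swap.adjacent (hd.trans Sym2.eq_swap))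
      · exact fun hd => h (hq.rotate.adjacent hd)
      · exact fun hd => h (hq.rotate.swap.adjacent (hd.trans Sym2.eq_swap))
    rw [hq'.flip_diag, hq.flip_diag]
  ext1
  funext k
  by_cases hc : k = c
  · subst hc
    rw [key _ _ hcd h, flip_diag_of_ne _ hcd]
  by_cases hd : k = d
  · subst hd
    rw [key _ _ hcd.symm fun h' => h h'.symm, flip_diag_of_ne _ hcd.symm]
  · rw [flip_diag_of_ne _ hd, flip_diag_of_ne _ hc, flip_diag_of_ne _ hc, flip_diag_of_ne _ hd]

/-- The effect of the flip of `v b` on the quadrilateral around the diagonal `v a`, for a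
triangle `v a b`. -/
theorem Quad.flip_of_adjacent {c d : Fin n} {v a b x y : Vertex n}
    (hc : t.Quad c v b a x) (hd : t.Quad d v a b y) : (t.flip d).Quad c v y a x := by
  have hva := (hasEdge_of_diag_eq hc.diag).ne
  have hvb := (hasEdge_of_diag_eq hd.diag).ne
  have hcd : c ≠ d := by
    rintro rfl
    have := hc.e2.ne
    have := hc.diag.symm.trans hd.diag
    rw [Sym2.eq_iff] at this
    grind
  have h1 := hc.e1.ne
  have h2 := hc.e2.ne
  have h3 := hc.e3.ne
  have h4 := hc.e4.ne
  have h5 := hd.e3.ne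
  have h6 := hd.e4.ne
  have h7 := hc.ne
  have h8 := hd.ne
  refine ⟨(t.flip_diag_of_ne hcd).trans hc.diag, ?_, hd.e4.swap.flip ?_, ?_, hc.e3.flip ?_,
    hc.e4.flip ?_⟩
  · rintro rfl
    exact hc.not_hasEdge hd.e3
  · rw [hd.diag, Ne, Sym2.eq_iff]
    grind
  · exact hasEdge_of_diag_eq (hd.flip_diag.trans Sym2.eq_swap)
  · rw [hd.diag, Ne, Sym2.eq_iff]
    grind
  · rw [hd.diag, Ne, Sym2.eq_iff]
    grind

theorem not_adjacent_of_flip_comm {c d : Fin n} (hcd : c ≠ d)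
    (h : (t.flip c).flip d = (t.flip d).flip c) : ¬ t.Adjacent c d := by
  rintro ⟨v, a, b, h1, h2, h3⟩
  obtain ⟨x, hx⟩ := exists_quad_of_third h1 (hasEdge_of_diag_eq h2) h3.swap
  obtain ⟨y, hy⟩ := exists_quad_of_third h2 (hasEdge_of_diag_eq h1) h3
  -- Color `c` ends at `y x` if `d` is flipped first, and at `b x` if `c` is flipped first; but `b
  -- y` is an edge, so `b ≠ y`.
  have h4 := (hx.flip_of_adjacent hy).flip_diag
  rw [← h, flip_diag_of_ne _ hcd, hx.flip_diag, Sym2.congr_left] at h4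
  exact hy.e3.ne h4

/-- This expresses adjacency by flips alone, so every injective map commuting with flips preserves
it. -/
theorem adjacent_iff {c d : Fin n} (hcd : c ≠ d) :
    t.Adjacent c d ↔ (t.flip c).flip d ≠ (t.flip d).flip c :=
  ⟨fun h h' => not_adjacent_of_flip_comm hcd h' h,
    fun h => not_not.1 fun h' => h (flip_comm_of_not_adjacent hcd h')⟩

theorem Adjacent.exists_third {c d : Fin n} {v a : Vertex n} (h : t.Adjacent c d)
    (hc : t.diag c = s(v, a)) : ∃ z, (t.diag d = s(v, z) ∨ t.diag d = s(a, z)) ∧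
      t.HasEdge s(v, z) ∧ t.HasEdge s(z, a) := by
  obtain ⟨p, q, z, h1, h2, h3⟩ := h
  rcases Sym2.eq_iff.1 (h1.symm.trans hc) with ⟨rfl, rfl⟩ | ⟨rfl, rfl⟩
  · exact ⟨z, Or.inl h2, hasEdge_of_diag_eq h2, h3.swap⟩
  · exact ⟨z, Or.inr h2, h3, (hasEdge_of_diag_eq h2).swap⟩

/-- If `v a` and `v b` are the diagonals of colors `i` and `j` in a triangle `v a b`, and the
diagonal of color `k` is adjacent to that of color `j`, and to that of color `i` after the flip
of color `j`, then it has the end point `v`, too. -/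
theorem diag_eq_of_adjacent {i j k : Fin n} {v a b : Vertex n} (hik : i ≠ k)
    (hjk : j ≠ k) (hi : t.diag i = s(v, a)) (hj : t.diag j = s(v, b)) (hab : t.HasEdge s(a, b))
    (h1 : t.Adjacent j k) (h2 : (t.flip j).Adjacent i k) :
    ∃ w, t.diag k = s(v, w) ∧ t.HasEdge s(b, w) := by
  obtain ⟨x, hx⟩ := exists_quad_of_third hi (hasEdge_of_diag_eq hj) hab.swap
  obtain ⟨w, hw⟩ := exists_quad_of_third hj (hasEdge_of_diag_eq hi) hab
  have hu := hx.flip_of_adjacent hw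
  obtain ⟨z, hz, e1, e2⟩ := h2.exists_third hu.diag
  obtain ⟨z', hz', e1', e2'⟩ := h1.exists_third hj
  rw [flip_diag_of_ne _ hjk.symm] at hz
  have n1 := hx.ne
  have n2 := hx.e1.ne
  have n3 := hx.e2.ne
  have n4 := hx.e3.ne
  have n5 := hx.e4.ne
  have n6 := hw.ne
  have n7 := hw.e3.ne
  have n8 := hw.e4.ne
  have n9 := hu.ne
  have n10 := (hasEdge_of_diag_eq hi).ne
  have m1 : t.diag k ≠ s(v, a) := fun h => hik (t.injective (hi.trans h.symm))
  have m2 : t.diag k ≠ s(a, w) := fun h => by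
    rw [← flip_diag_of_ne t hjk.symm, ← hw.flip_diag] at h
    exact hjk ((t.flip j).injective h.symm)
  -- After the flip of `j`, the quadrilateral around `v a` is `v w a x`, so color `k` is on a side
  -- at `w` or at `x`. At `w` only `v w` is possible, as `a w` has color `j`. At `x` it would not
  -- meet the triangles next to `v b`.
  rcases hu.third e1 e2 with rfl | rfl
  · rcases hz with hz | hz
    · exact ⟨z, hz, hw.e3⟩
    · exact absurd hz m2
  · exfalso
    rcases hw.third e1' e2' with rfl | rfl
    · rcases hz with hz | hz <;> rcases hz' with hz' | hz' <;> rw [hz] at hz' m1 m2 <;>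
        rw [Sym2.eq_iff] at hz' <;> grind
    · rcases hz with hz | hz <;> rcases hz' with hz' | hz' <;> rw [hz] at hz' m1 m2 <;>
        rw [Sym2.eq_iff] at hz' <;> grind

end ColoredTriangulation

/-! ### Reachability in terms of flips -/

theorem polygonSymm_r (i x : Vertex n) : polygonSymm n (.r i) x = x + i := rfl

theorem polygonSymm_sr (i x : Vertex n) : polygonSymm n (.sr i) x = -(x + i) := rfl

theorem val_natCast_vertex {k : ℕ} (hk : k < n + 3) : (k : Vertex n).val = k :=
  ZMod.val_natCast_of_lt hk

theorem val_add_one_of_ne {x : Vertex n} (h : x + 1 ≠ 0) : (x + 1).val = x.val + 1 := by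
  have h1 := val_add_cases x 1
  rw [val_one_vertex] at h1
  have h2 := (ZMod.val_ne_zero _).2 h
  have := ZMod.val_lt x
  omega

theorem exchangeGraph_adj {C : Finset (Fin n)} {t t' : ColoredTriangulation n} :
    (exchangeGraph n C).Adj t t' ↔ ∃ c ∈ C, t' = t.flip c := by
  simp only [exchangeGraph, ColoredTriangulation.isFlip_iff]

theorem reachable_flip {C : Finset (Fin n)} (t : ColoredTriangulation n) {c : Fin n}
    (hc : c ∈ C) : (exchangeGraph n C).Reachable t (t.flip c) :=
  (exchangeGraph_adj.2 ⟨c, hc, rfl⟩).reachable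

/-- A set of colored triangulations is closed under reachability as soon as it is closed under
the flips of the given colors. -/
theorem reachable_induction {C : Finset (Fin n)} {P : ColoredTriangulation n → Prop}
    (hP : ∀ t, ∀ c ∈ C, P t → P (t.flip c)) {t t' : ColoredTriangulation n}
    (h : (exchangeGraph n C).Reachable t t') (ht : P t) : P t' := by
  obtain ⟨w⟩ := h
  induction w with
  | nil => exact ht
  | cons hadj _ ih =>
    obtain ⟨c, hc, rfl⟩ := exchangeGraph_adj.1 hadj
    exact ih (hP _ c hc ht)

/-- A map which intertwines flips, up to a change of colors, preserves reachability. -/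
theorem reachable_map_flip {C : Finset (Fin n)} {g : ColoredTriangulation n → ColoredTriangulation n}
    {σ : Fin n ↪ Fin n} (hg : ∀ t c, g (t.flip c) = (g t).flip (σ c))
    {t t' : ColoredTriangulation n} (h : (exchangeGraph n C).Reachable t t') :
    (exchangeGraph n (C.map σ)).Reachable (g t) (g t') := by
  refine reachable_induction (P := fun u => (exchangeGraph n (C.map σ)).Reachable (g t) (g u))
    (fun u c hc hu => hu.trans ?_) h (SimpleGraph.Reachable.refl _)
  rw [hg]
  exact reachable_flip _ (Finset.mem_map_of_mem σ hc)

namespace ColoredTriangulation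

variable {t : ColoredTriangulation n}

/-! ### Pentagons -/

/-- `p₀ p₁ p₂ p₃ p₄` is a pentagon, divided by the diagonals of colors `c` and `d` through
`p₀`. -/
structure Pentagon (t : ColoredTriangulation n) (c d : Fin n) (p₀ p₁ p₂ p₃ p₄ : Vertex n) :
    Prop where
  diag_left : t.diag c = s(p₀, p₂)
  diag_right : t.diag d = s(p₀, p₃)
  e₀₁ : t.HasEdge s(p₀, p₁)
  e₁₂ : t.HasEdge s(p₁, p₂)
  e₂₃ : t.HasEdge s(p₂, p₃)
  e₃₄ : t.HasEdge s(p₃, p₄)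
  e₄₀ : t.HasEdge s(p₄, p₀)
  n₁₃ : p₁ ≠ p₃
  n₁₄ : p₁ ≠ p₄
  n₂₄ : p₂ ≠ p₄

theorem Pentagon.ne {c d : Fin n} {p₀ p₁ p₂ p₃ p₄ : Vertex n}
    (h : t.Pentagon c d p₀ p₁ p₂ p₃ p₄) : c ≠ d := by
  rintro rfl
  exact h.e₂₃.ne (Sym2.congr_right.1 (h.diag_left.symm.trans h.diag_right))

/-- Replacing `p₀ p₂` by `p₁ p₃` leaves two diagonals through `p₃`: the labels shift by three and
the colors change roles. -/
theorem Pentagon.flip {c d : Fin n} {p₀ p₁ p₂ p₃ p₄ : Vertex n}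
    (h : t.Pentagon c d p₀ p₁ p₂ p₃ p₄) : (t.flip c).Pentagon d c p₃ p₄ p₀ p₁ p₂ := by
  have hq : t.Quad c p₀ p₁ p₂ p₃ :=
    ⟨h.diag_left, h.n₁₃, h.e₀₁, h.e₁₂, h.e₂₃, (hasEdge_of_diag_eq h.diag_right).swap⟩
  have n₀₂ := (hasEdge_of_diag_eq h.diag_left).ne
  have n₀₃ := (hasEdge_of_diag_eq h.diag_right).ne
  have n₀₁ := h.e₀₁.ne
  have n₁₂ := h.e₁₂.ne
  have n₂₃ := h.e₂₃.ne
  have n₃₄ := h.e₃₄.ne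
  have n₄₀ := h.e₄₀.ne
  have n₁₃ := h.n₁₃
  have n₁₄ := h.n₁₄
  have n₂₄ := h.n₂₄
  refine ⟨?_, ?_, h.e₃₄.flip ?_, h.e₄₀.flip ?_, h.e₀₁.flip ?_, h.e₁₂.flip ?_, h.e₂₃.flip ?_,
    n₁₄.symm, n₂₄.symm, n₀₂⟩
  · rw [flip_diag_of_ne _ h.ne.symm, h.diag_right, Sym2.eq_swap]
  · rw [hq.flip_diag, Sym2.eq_swap]
  all_goals
    rw [h.diag_left, Ne, Sym2.eq_iff]
    grind

/-- Five flips in a pentagon exchange the colors of its two diagonals. -/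
theorem Pentagon.flip_five {c d : Fin n} {p₀ p₁ p₂ p₃ p₄ : Vertex n}
    (h : t.Pentagon c d p₀ p₁ p₂ p₃ p₄) :
    ((((t.flip c).flip d).flip c).flip d).flip c = t.recolor (Equiv.swap c d) := by
  -- Five shifts by three restore the labels modulo five, while an odd number of role changes
  -- exchanges the colors.
  have h5 := h.flip.flip.flip.flip.flip
  ext1
  funext k
  rw [recolor_diag, Equiv.swap_inv]
  by_cases hc : k = c
  · subst hc
    rw [h5.diag_right, Equiv.swap_apply_left, h.diag_right]
  by_cases hd : k = d
  · subst hd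
    rw [h5.diag_left, Equiv.swap_apply_right, h.diag_left]
  rw [Equiv.swap_apply_of_ne_of_ne hc hd]
  simp only [flip_diag_of_ne _ hc, flip_diag_of_ne _ hd]

theorem Pentagon.reachable_recolor {c d : Fin n} {p₀ p₁ p₂ p₃ p₄ : Vertex n}
    (h : t.Pentagon c d p₀ p₁ p₂ p₃ p₄) :
    (exchangeGraph n Finset.univ).Reachable t (t.recolor (Equiv.swap c d)) := by
  rw [← h.flip_five]
  have key := fun (u : ColoredTriangulation n) k => reachable_flip u (Finset.mem_univ k)
  exact ((((key _ _).trans (key _ _)).trans (key _ _)).trans (key _ _)).trans (key _ _)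

/-! ### Fans -/

theorem sbtw_zero_iff {x y : Vertex n} : sbtw 0 x y ↔ 0 < x.val ∧ x.val < y.val := by
  rw [sbtw_iff_left, sub_zero, sub_zero]

/-- The fan triangulation, all of whose diagonals end in the vertex `0`. -/
def fan (n : ℕ) : ColoredTriangulation n where
  -- The diagonals at `0` end at `2, …, n + 1`, while colors are counted from `0`.
  diag i := s(0, ((i + 2 : ℕ) : Vertex n))
  injective := by
    intro i j h
    have h := congrArg ZMod.val (Sym2.congr_right.1 h)
    rw [val_natCast_vertex (by omega), val_natCast_vertex (by omega)] at h
    omega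
  isTriangulation := by
    refine ⟨⟨?_, ?_⟩, ?_⟩
    · rintro _ ⟨i, rfl⟩
      refine isDiagonal_of_sbtw (b := 1) (b' := ((n + 2 : ℕ) : Vertex n)) ?_ ?_
      · rw [sbtw_zero_iff, val_one_vertex, val_natCast_vertex (by omega)]
        omega
      · rw [sbtw_iff_val, ZMod.val_zero, val_natCast_vertex (by omega),
          val_natCast_vertex (by omega)]
        omega
    · rintro _ ⟨i, rfl⟩ _ ⟨j, rfl⟩ h
      rcases crosses_mk.1 h with ⟨h, h'⟩ | ⟨h, h'⟩
      · exact (sbtw_ne h).1 rfl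
      · exact (sbtw_ne h').2.1 rfl
    · rintro S ⟨hS1, hS2⟩ hTS e he
      have hd := hS1 e he
      have hmem : ∀ x : Vertex n, 2 ≤ x.val → x.val < n + 2 → s(0, x) ∈ S ∧
          s(0, x) ∈ Set.range fun i : Fin n => s(0, ((i + 2 : ℕ) : Vertex n)) := by
        intro x h1 h2
        have : s(0, x) ∈ Set.range fun i : Fin n => s(0, ((i + 2 : ℕ) : Vertex n)) := by
          refine ⟨⟨x.val - 2, by omega⟩, ?_⟩
          change s(0, ((x.val - 2 + 2 : ℕ) : Vertex n)) = s(0, x)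
          rw [Nat.sub_add_cancel h1, ZMod.natCast_zmod_val]
        exact ⟨hTS this, this⟩
      have hzero : ∀ x : Vertex n, IsDiagonal s(0, x) →
          s(0, x) ∈ Set.range fun i : Fin n => s(0, ((i + 2 : ℕ) : Vertex n)) := by
        intro x hx
        obtain ⟨y, hy⟩ := hx.exists_sbtw
        rw [Sym2.eq_swap] at hx
        obtain ⟨z, hz⟩ := hx.exists_sbtw
        rw [sbtw_zero_iff] at hy
        rw [sbtw_iff_val, ZMod.val_zero] at hz
        have := ZMod.val_lt z
        exact (hmem x (by omega) (by omega)).2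
      -- As `p q` is not a side, `p + 1` lies strictly between `p` and `q`, so the fan diagonal `0
      -- (p + 1)` crosses it.
      have hpos : ∀ p q : Vertex n, 0 < p.val → p.val < q.val → s(p, q) ∈ S → False := by
        intro p q hp hpq h
        have hlt := ZMod.val_lt q
        have h1 : (p + 1).val = p.val + 1 := by
          have := val_add_cases p 1
          rw [val_one_vertex] at this
          omega
        have h2 : q ≠ p + 1 := by
          rintro rfl
          exact (hS1 _ h).2 ⟨p, rfl⟩
        have h2 := (ZMod.val_injective (n + 3)).ne h2
        refine hS2 _ (hmem (p + 1) (by omega) (by omega)).1 _ h (crosses_of_lt 0 ?_ ?_ ?_) <;>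
          simp only [sub_zero, ZMod.val_zero] <;> omega
      induction e with | _ p q =>
      by_cases hp : p = 0
      · rw [hp] at hd ⊢
        exact hzero q hd
      by_cases hq : q = 0
      · rw [hq, Sym2.eq_swap] at hd ⊢
        exact hzero p hd
      have hp := Nat.pos_of_ne_zero ((ZMod.val_ne_zero p).2 hp)
      have hq := Nat.pos_of_ne_zero ((ZMod.val_ne_zero q).2 hq)
      rcases lt_trichotomy p.val q.val with h | h | h
      · exact (hpos p q hp h he).elim
      · exact absurd (ZMod.val_injective _ h) hd.1
      · rw [Sym2.eq_swap] at he
        exact (hpos q p hq h he).elim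

theorem fan_diag (i : Fin n) : (fan n).diag i = s(0, ((i + 2 : ℕ) : Vertex n)) := rfl

theorem fan_hasEdge_zero {k : ℕ} (h1 : 1 ≤ k) (h2 : k ≤ n + 2) :
    (fan n).HasEdge s(0, (k : Vertex n)) := by
  rcases Nat.lt_or_ge 1 k with h3 | h3
  · rcases Nat.lt_or_ge k (n + 2) with h4 | h4
    · refine hasEdge_of_diag_eq (c := ⟨k - 2, by omega⟩) ?_
      rw [fan_diag]
      simp only [Nat.sub_add_cancel h3]
    · obtain rfl : k = n + 2 := by omega
      refine Or.inl ⟨((n + 2 : ℕ) : Vertex n), ?_⟩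
      have : ((n + 2 : ℕ) : Vertex n) + 1 = ((n + 3 : ℕ) : Vertex n) := by push_cast; ring
      rw [this, ZMod.natCast_self, Sym2.eq_swap]
  · obtain rfl : k = 1 := by omega
    exact Or.inl ⟨0, by simp⟩

theorem hasEdge_succ (t : ColoredTriangulation n) (k : ℕ) :
    t.HasEdge s((k : Vertex n), ((k + 1 : ℕ) : Vertex n)) :=
  Or.inl ⟨k, by push_cast; rfl⟩

theorem natCast_vertex_ne {k l : ℕ} (hk : k < n + 3) (hl : l < n + 3) (h : k ≠ l) :
    (k : Vertex n) ≠ (l : Vertex n) := by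
  intro h'
  have := congrArg ZMod.val h'
  rw [val_natCast_vertex hk, val_natCast_vertex hl] at this
  exact h this

theorem fan_pentagon {i j : Fin n} (h : (j : ℕ) = i + 1) :
    (fan n).Pentagon i j 0 ((i + 1 : ℕ) : Vertex n) ((i + 2 : ℕ) : Vertex n)
      ((i + 3 : ℕ) : Vertex n) ((i + 4 : ℕ) : Vertex n) where
  diag_left := rfl
  diag_right := by rw [fan_diag, h]
  e₀₁ := fan_hasEdge_zero (by omega) (by omega)
  e₁₂ := hasEdge_succ _ _
  e₂₃ := hasEdge_succ _ _
  e₃₄ := hasEdge_succ _ _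
  e₄₀ := (fan_hasEdge_zero (by omega) (by omega)).swap
  n₁₃ := natCast_vertex_ne (by omega) (by omega) (by omega)
  n₁₄ := natCast_vertex_ne (by omega) (by omega) (by omega)
  n₂₄ := natCast_vertex_ne (by omega) (by omega) (by omega)

theorem fan_adjacent {i j : Fin n} (h : (j : ℕ) = i + 1) : (fan n).Adjacent i j :=
  ⟨_, _, _, (fan_pentagon h).diag_left, (fan_pentagon h).diag_right, (fan_pentagon h).e₂₃⟩

/-- The flipped diagonal joins `i + 2` to `i + 4` and closes a triangle at `0`. -/
theorem fan_flip_adjacent {i j k : Fin n} (hij : (j : ℕ) = i + 1) (hjk : (k : ℕ) = i + 2) :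
    ((fan n).flip j).Adjacent i k := by
  have hp := fan_pentagon hij
  have hk : (fan n).diag k = s(0, ((i + 4 : ℕ) : Vertex n)) := by rw [fan_diag, hjk]
  have hq : (fan n).Quad j 0 ((i + 2 : ℕ) : Vertex n) ((i + 3 : ℕ) : Vertex n)
      ((i + 4 : ℕ) : Vertex n) :=
    ⟨hp.diag_right, hp.n₂₄, hasEdge_of_diag_eq hp.diag_left, hp.e₂₃, hp.e₃₄, hp.e₄₀⟩
  refine ⟨_, _, _, (flip_diag_of_ne _ hp.ne).trans hp.diag_left,
    (flip_diag_of_ne _ ?_).trans hk, hasEdge_of_diag_eq hq.flip_diag⟩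
  rintro rfl
  omega

/-! ### Connectedness of the exchange graph -/

theorem recolor_mul (σ τ : Equiv.Perm (Fin n)) (t : ColoredTriangulation n) :
    t.recolor (σ * τ) = (t.recolor τ).recolor σ := by
  ext1
  funext k
  simp

theorem recolor_one (t : ColoredTriangulation n) : t.recolor 1 = t := rfl

theorem reachable_recolor {t t' : ColoredTriangulation n} (σ : Equiv.Perm (Fin n))
    (h : (exchangeGraph n Finset.univ).Reachable t t') :
    (exchangeGraph n Finset.univ).Reachable (t.recolor σ) (t'.recolor σ) := by
  have := reachable_map_flip (g := recolor σ) (σ := σ.toEmbedding) (recolor_flip σ) h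
  rwa [Finset.map_univ_equiv] at this

theorem fan_reachable_recolor (σ : Equiv.Perm (Fin n)) :
    (exchangeGraph n Finset.univ).Reachable (fan n) ((fan n).recolor σ) := by
  -- The recolorings reachable from the fan form a submonoid; it contains the transpositions of
  -- neighboring colors by the pentagon flips, and these generate.
  let M : Submonoid (Equiv.Perm (Fin n)) :=
    { carrier := {σ | (exchangeGraph n Finset.univ).Reachable (fan n) ((fan n).recolor σ)}
      one_mem' := SimpleGraph.Reachable.refl _
      mul_mem' := fun {σ τ} hσ hτ => by
        rw [Set.mem_ofPred_eq, recolor_mul]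
        exact SimpleGraph.Reachable.trans hσ (reachable_recolor σ hτ) }
  suffices h : M = ⊤ from (h ▸ Submonoid.mem_top σ : σ ∈ M)
  rcases n with _ | m
  · exact Subsingleton.elim _ _
  · rw [eq_top_iff, ← Equiv.Perm.mclosure_swap_castSucc_succ, Submonoid.closure_le]
    rintro _ ⟨i, rfl⟩
    exact (fan_pentagon (by simp)).reachable_recolor

theorem exists_flip_at_zero (h : ¬ ∀ x, x ≠ 0 → t.HasEdge s(0, x)) :
    ∃ c, 0 ∉ t.diag c ∧ 0 ∈ (t.flip c).diag c := by
  -- At such an `x`, the triangle on `0 x` towards `x + 1` has an apex `y ≠ x + 1`, so `x y` is a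
  -- diagonal, and its flip ends at `0`.
  have key : ∃ x, x ≠ 0 ∧ t.HasEdge s(0, x) ∧ x + 1 ≠ 0 ∧ ¬ t.HasEdge s(0, x + 1) := by
    by_contra! hc
    apply h
    have : ∀ k : ℕ, k + 1 < n + 3 → t.HasEdge s(0, ((k + 1 : ℕ) : Vertex n)) := by
      intro k
      induction k with
      | zero => exact fun _ => Or.inl ⟨0, by simp⟩
      | succ k ih =>
        intro hk
        have h1 := natCast_vertex_ne (n := n) (k := k + 1) (l := 0) (by omega) (by omega) (by omega)
        have h2 := natCast_vertex_ne (n := n) (k := k + 1 + 1) (l := 0) hk (by omega) (by omega)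
        rw [Nat.cast_zero] at h1 h2
        rw [Nat.cast_succ] at h2 ⊢
        exact hc _ h1 (ih (by omega)) h2
    intro x hx
    have h1 := (ZMod.val_ne_zero x).2 hx
    have h2 := this (x.val - 1) (by have := ZMod.val_lt x; omega)
    rwa [Nat.sub_add_cancel (by omega), ZMod.natCast_zmod_val] at h2
  obtain ⟨x, h1, h2, h3, h4⟩ := key
  rcases side_or_sbtw h1 with h5 | ⟨y, hy⟩
  · exact absurd h5.symm h3
  obtain ⟨y, hy, e1, e2⟩ := h2.swap.exists_third hy
  rcases e1 with ⟨i, hi⟩ | ⟨c, hc⟩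
  · exfalso
    rcases Sym2.eq_iff.1 hi with ⟨rfl, rfl⟩ | ⟨rfl, rfl⟩
    · exact h4 e2.swap
    · apply not_sbtw_succ y 0
      rw [sbtw_iff_val] at hy ⊢
      omega
  · obtain ⟨z, hz⟩ := exists_quad_of_third hc h2.swap e2.swap
    refine ⟨c, ?_, ?_⟩
    · rw [hc, Sym2.mem_iff]
      rintro (rfl | rfl)
      · exact h1 rfl
      · exact e2.ne rfl
    · rw [hz.flip_diag]
      exact Sym2.mem_mk_left _ _

theorem eq_fan_recolor (h : ∀ x, x ≠ 0 → t.HasEdge s(0, x)) : ∃ σ, t = (fan n).recolor σ := by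
  have : ∀ i, ∃ j, t.diag j = (fan n).diag i := by
    intro i
    have hi := (fan n).hasEdge_diag i
    rw [fan_diag] at hi
    exact (h _ hi.ne.symm).resolve_left ((fan n).isDiagonal i).2
  choose f hf using this
  have hinj : Function.Injective f := fun i j hij =>
    (fan n).injective (by rw [← hf, ← hf, hij])
  refine ⟨Equiv.ofBijective f (Finite.injective_iff_bijective.1 hinj), ?_⟩
  ext1
  funext k
  rw [recolor_diag, ← hf]
  congr 1
  exact ((Equiv.ofBijective f _).apply_symm_apply k).symm

/-- Induction on the number of diagonals avoiding `0`. -/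
theorem reachable_fan_recolor (t : ColoredTriangulation n) :
    ∃ σ, (exchangeGraph n Finset.univ).Reachable t ((fan n).recolor σ) := by
  classical
  induction hk : (Finset.univ.filter fun c => 0 ∉ t.diag c).card using Nat.strong_induction_on
    generalizing t with | _ k ih =>
  by_cases h : ∀ x, x ≠ 0 → t.HasEdge s(0, x)
  · obtain ⟨σ, rfl⟩ := eq_fan_recolor h
    exact ⟨σ, SimpleGraph.Reachable.refl _⟩
  obtain ⟨c, h1, h2⟩ := exists_flip_at_zero h
  obtain ⟨σ, hσ⟩ := ih _ (by
    rw [← hk]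
    refine Finset.card_lt_card ⟨fun d hd => ?_, fun hsub => ?_⟩
    · rw [Finset.mem_filter] at hd ⊢
      refine ⟨hd.1, ?_⟩
      rw [← t.flip_diag_of_ne (c := c)]
      · exact hd.2
      · rintro rfl
        exact hd.2 h2
    · exact (Finset.mem_filter.1 (hsub (Finset.mem_filter.2 ⟨Finset.mem_univ c, h1⟩))).2 h2)
    (t.flip c) rfl
  exact ⟨σ, (reachable_flip t (Finset.mem_univ c)).trans hσ⟩

theorem fan_reachable (t : ColoredTriangulation n) :
    (exchangeGraph n Finset.univ).Reachable (fan n) t := by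
  obtain ⟨σ, h⟩ := t.reachable_fan_recolor
  exact (fan_reachable_recolor σ).trans h.symm

/-- The exchange graph is connected. -/
theorem flip_induction {P : ColoredTriangulation n → Prop} (h : P (fan n))
    (hP : ∀ t c, P t → P (t.flip c)) (t : ColoredTriangulation n) : P t :=
  reachable_induction (fun t c _ => hP t c) t.fan_reachable h

end ColoredTriangulation

/-! ### Recognizing the fan from its adjacencies -/

/-- A sequence of distinct integers in an interval, with steps `± 1`, which fills the interval, is
increasing or decreasing. -/
theorem eq_add_or_eq_sub_of_step {n : ℕ} (hn : 2 ≤ n) {p : ℕ → ℕ}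
    (hstep : ∀ m, m + 1 < n → p (m + 1) = p m + 1 ∨ p m = p (m + 1) + 1)
    (hne : ∀ m, m + 2 < n → p (m + 2) ≠ p m)
    (hlow : ∀ m < n, 2 ≤ p m) (hhigh : ∀ m < n, p m ≤ n + 1) :
    (∀ m < n, p m = m + 2) ∨ ∀ m < n, p m + m = n + 1 := by
  have h0 := hlow 0 (by omega)
  have h0' := hhigh 0 (by omega)
  have hl := hlow (n - 1) (by omega)
  have hh := hhigh (n - 1) (by omega)
  rcases hstep 0 (by omega) with h | h
  · left
    -- A change of direction would give `p (m + 2) = p m`. The `n` values then fill `2, …, n + 1`,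
    -- which fixes `p 0`.
    have key : ∀ m, m + 1 < n → p (m + 1) = p m + 1 := by
      intro m
      induction m with
      | zero => exact fun _ => h
      | succ m ih =>
        intro hm
        have := ih (by omega)
        have := hne m hm
        have := hstep (m + 1) hm
        grind
    have key' : ∀ m < n, p m = p 0 + m := by
      intro m
      induction m with
      | zero => simp
      | succ m ih =>
        intro hm
        have := ih (by omega)
        have := key m hm
        omega
    intro m hm
    have := key' m hm
    have := key' (n - 1) (by omega)
    omega
  · right
    have key : ∀ m, m + 1 < n → p m = p (m + 1) + 1 := by
      intro m
      induction m with
      | zero => exact fun _ => h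
      | succ m ih =>
        intro hm
        have := ih (by omega)
        have := hne m hm
        have := hstep (m + 1) hm
        grind
    have key' : ∀ m < n, p m + m = p 0 := by
      intro m
      induction m with
      | zero => simp
      | succ m ih =>
        intro hm
        have := ih (by omega)
        have := key m hm
        omega
    intro m hm
    have := key' m hm
    have := key' (n - 1) (by omega)
    omega

namespace ColoredTriangulation

variable {t : ColoredTriangulation n}

/-- The diagonals of a colored triangulation with the adjacency pattern of the fan have a common
end point. -/
theorem exists_common_vertex (hn : 2 ≤ n)
    (h1 : ∀ i j : Fin n, (j : ℕ) = i + 1 → t.Adjacent i j)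
    (h2 : ∀ i j k : Fin n, (j : ℕ) = i + 1 → (k : ℕ) = i + 2 → (t.flip j).Adjacent i k) :
    ∃ (v : Vertex n) (w : Fin n → Vertex n), (∀ i, t.diag i = s(v, w i)) ∧
      ∀ i j : Fin n, (j : ℕ) = i + 1 → t.HasEdge s(w i, w j) := by
  obtain ⟨v, a, b, ha, hb, hab⟩ := h1 ⟨0, by omega⟩ ⟨1, by omega⟩ rfl
  have key : ∀ m (hm : m + 1 < n), ∃ a b, t.diag ⟨m, by omega⟩ = s(v, a) ∧
      t.diag ⟨m + 1, hm⟩ = s(v, b) ∧ t.HasEdge s(a, b) := by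
    intro m
    induction m with
    | zero => exact fun _ => ⟨a, b, ha, hb, hab⟩
    | succ m ih =>
      intro hm
      obtain ⟨a, b, ha, hb, hab⟩ := ih (by omega)
      obtain ⟨w, hw, hbw⟩ := diag_eq_of_adjacent (k := ⟨m + 2, hm⟩) (by simp) (by simp) ha hb hab
        (h1 _ _ rfl) (h2 _ _ _ rfl rfl)
      exact ⟨b, w, hb, hw, hbw⟩
  have hex : ∀ i : Fin n, ∃ w, t.diag i = s(v, w) := by
    rintro ⟨m, hm⟩
    rcases m with _ | m
    · exact ⟨a, ha⟩
    · obtain ⟨_, b, -, hb, -⟩ := key m hm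
      exact ⟨b, hb⟩
  choose w hw using hex
  refine ⟨v, w, hw, ?_⟩
  rintro ⟨i, hi⟩ ⟨j, hj⟩ hij
  obtain rfl : j = i + 1 := hij
  obtain ⟨a, b, ha, hb, hab⟩ := key i hj
  rw [hw, Sym2.congr_right] at ha hb
  rwa [ha, hb]

/-- All diagonals meet in `v`, so consecutive other ends, joined by an edge avoiding `v`, are
neighbors on the polygon. Their distances from `v` thus increase, giving a rotated fan, or decrease,
giving a reflected one. -/
theorem exists_eq_fan_move (hn : 2 ≤ n)
    (h1 : ∀ i j : Fin n, (j : ℕ) = i + 1 → t.Adjacent i j)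
    (h2 : ∀ i j k : Fin n, (j : ℕ) = i + 1 → (k : ℕ) = i + 2 → (t.flip j).Adjacent i k) :
    ∃ γ, t = (fan n).move γ := by
  obtain ⟨v, w, hw, hedge⟩ := exists_common_vertex hn h1 h2
  have hinj : Function.Injective w := fun i j hij => t.injective (by rw [hw, hw, hij])
  have hvw : ∀ i, v ≠ w i := fun i => (hasEdge_of_diag_eq (hw i)).ne
  have hpos : ∀ i, (w i - v).val ≠ 0 := fun i =>
    (ZMod.val_ne_zero _).2 (sub_ne_zero.2 (hvw i).symm)
  have hside : ∀ i j : Fin n, (j : ℕ) = i + 1 → IsSide s(w i, w j) := by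
    intro i j hij
    refine (hedge i j hij).resolve_right ?_
    rintro ⟨k, hk⟩
    rw [hw] at hk
    have : v ∈ s(w i, w j) := hk ▸ Sym2.mem_mk_left v (w k)
    rcases Sym2.mem_iff.1 this with h | h
    · exact hvw _ h
    · exact hvw _ h
  have hsucc : ∀ i j : Fin n, w j = w i + 1 → (w j - v).val = (w i - v).val + 1 := by
    intro i j hij
    have : w j - v = w i - v + 1 := by rw [hij]; ring
    rw [this]
    apply val_add_one_of_ne
    rw [← this]
    exact sub_ne_zero.2 (hvw j).symm
  have hbounds : ∀ i, 2 ≤ (w i - v).val ∧ (w i - v).val ≤ n + 1 := by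
    intro i
    have hd := t.isDiagonal i
    rw [hw] at hd
    obtain ⟨y, hy⟩ := hd.exists_sbtw
    rw [Sym2.eq_swap] at hd
    obtain ⟨z, hz⟩ := hd.exists_sbtw
    rw [sbtw_iff_left] at hy
    rw [sbtw_iff_right] at hz
    have := ZMod.val_lt (z - v)
    omega
  let p : ℕ → ℕ := fun m => if h : m < n then (w ⟨m, h⟩ - v).val else 0
  have hp : ∀ m (h : m < n), p m = (w ⟨m, h⟩ - v).val := fun m h => dif_pos h
  have hmono := eq_add_or_eq_sub_of_step hn (p := p) ?_ ?_ ?_ ?_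
  · rcases hmono with h | h
    · refine ⟨.r v, ?_⟩
      ext1
      funext i
      rw [hw, move_diag, fan_diag, moveSegment_mk, polygonSymm_r, polygonSymm_r, zero_add,
        Sym2.congr_right]
      have h3 := h i i.2
      rw [hp _ i.2] at h3
      have h4 := ZMod.natCast_zmod_val (w i - v)
      rw [h3] at h4
      rw [h4]
      ring
    -- This reflection is `x ↦ v - x`.
    · refine ⟨.sr (-v), ?_⟩
      ext1
      funext i
      rw [hw, move_diag, fan_diag, moveSegment_mk, polygonSymm_sr, polygonSymm_sr, zero_add,
        neg_neg, Sym2.congr_right]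
      have h3 := h i i.2
      rw [hp _ i.2] at h3
      have h4 : (w i - v) + ((i + 2 : ℕ) : Vertex n) = 0 := by
        rw [← ZMod.natCast_zmod_val (w i - v), ← Nat.cast_add, ← add_assoc, h3,
          ZMod.natCast_self]
      linear_combination h4
  · intro m hm
    rw [hp m (by omega), hp (m + 1) hm]
    obtain ⟨x, hx⟩ := hside ⟨m, by omega⟩ ⟨m + 1, hm⟩ rfl
    rcases Sym2.eq_iff.1 hx with ⟨h3, h4⟩ | ⟨h3, h4⟩
    · exact Or.inl (hsucc _ _ (by rw [h3, h4]))
    · exact Or.inr (hsucc _ _ (by rw [h3, h4]))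
  · intro m hm
    rw [hp m (by omega), hp (m + 2) hm, Ne, val_sub_inj, hinj.eq_iff]
    simp
  · intro m hm
    rw [hp m hm]
    exact (hbounds _).1
  · intro m hm
    rw [hp m hm]
    exact (hbounds _).2

/-- The injective maps which commute with all flips are the symmetries of the polygon. -/
theorem exists_eq_move (hn : 2 ≤ n) {g : ColoredTriangulation n → ColoredTriangulation n}
    (hinj : Function.Injective g) (hg : ∀ t c, g (t.flip c) = (g t).flip c) :
    ∃ γ, ∀ t, g t = t.move γ := by
  have hadj : ∀ t (c d : Fin n), c ≠ d → t.Adjacent c d → (g t).Adjacent c d := by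
    intro t c d hcd h
    rw [adjacent_iff hcd] at h ⊢
    rw [← hg, ← hg, ← hg, ← hg]
    exact hinj.ne h
  obtain ⟨γ, hγ⟩ := exists_eq_fan_move (t := g (fan n)) hn
    (fun i j hij => hadj _ _ _ (by rintro rfl; omega) (fan_adjacent hij))
    (fun i j k hij hik => by
      rw [← hg]
      exact hadj _ _ _ (by rintro rfl; omega) (fan_flip_adjacent hij hik))
  refine ⟨γ, flip_induction hγ fun t c ht => ?_⟩
  rw [hg, ht, move_flip]

end ColoredTriangulation

open ColoredTriangulation

theorem perm_inv_apply_apply (σ : Equiv.Perm (Fin n)) (c : Fin n) : σ⁻¹ (σ c) = c :=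
  σ.symm_apply_apply c

/-! ### Faces -/

theorem mem_faceSet {C : Finset (Fin n)} {t t' : ColoredTriangulation n} :
    t' ∈ faceSet C t ↔ (exchangeGraph n C).Reachable t t' := Iff.rfl

theorem self_mem_faceSet (C : Finset (Fin n)) (t : ColoredTriangulation n) : t ∈ faceSet C t :=
  SimpleGraph.Reachable.refl _

theorem faceSet_eq_of_mem {C : Finset (Fin n)} {t t' : ColoredTriangulation n}
    (h : t' ∈ faceSet C t) : faceSet C t = faceSet C t' := by
  ext u
  exact ⟨fun hu => (SimpleGraph.Reachable.symm h).trans hu, fun hu => SimpleGraph.Reachable.trans h hu⟩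

/-- Flips of colors other than `c` never move the diagonal of color `c`. Hence a face determines its
set of colors. -/
theorem flip_mem_faceSet_iff {C : Finset (Fin n)} {t : ColoredTriangulation n} {c : Fin n} :
    t.flip c ∈ faceSet C t ↔ c ∈ C := by
  refine ⟨fun h => ?_, reachable_flip t⟩
  by_contra hc
  refine t.flip_diag_ne c (reachable_induction (P := fun u => u.diag c = t.diag c)
    (fun u d hd hu => ?_) h rfl)
  rw [u.flip_diag_of_ne (by rintro rfl; exact hc hd), hu]

theorem faceSet_empty (t : ColoredTriangulation n) : faceSet ∅ t = {t} := by
  ext u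
  refine ⟨fun h => ?_, fun h => h ▸ self_mem_faceSet _ _⟩
  exact reachable_induction (P := fun u => u = t) (by simp) h rfl

theorem faceSet_singleton (t : ColoredTriangulation n) (c : Fin n) :
    faceSet {c} t = {t, t.flip c} := by
  ext u
  constructor
  · intro h
    refine reachable_induction (P := fun u => u = t ∨ u = t.flip c) ?_ h (Or.inl rfl)
    rintro u d hd (rfl | rfl) <;> rw [Finset.mem_singleton.1 hd]
    · exact Or.inr rfl
    · exact Or.inl (ColoredTriangulation.flip_flip _ _)
  · rintro (rfl | rfl)
    · exact self_mem_faceSet _ _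
    · exact flip_mem_faceSet_iff.2 (Finset.mem_singleton_self c)

theorem image_faceSet (f : Equiv.Perm (ColoredTriangulation n)) (σ : Equiv.Perm (Fin n))
    (hf : ∀ t c, f (t.flip c) = (f t).flip (σ c)) (C : Finset (Fin n))
    (t : ColoredTriangulation n) : f '' faceSet C t = faceSet (C.map σ.toEmbedding) (f t) := by
  ext u
  constructor
  · rintro ⟨u, hu, rfl⟩
    exact reachable_map_flip (σ := σ.toEmbedding) hf hu
  · intro hu
    refine ⟨f.symm u, ?_, f.apply_symm_apply u⟩
    have := reachable_map_flip (g := f.symm) (σ := σ.symm.toEmbedding) (fun t c => by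
      rw [Equiv.symm_apply_eq, hf]; simp) hu
    rw [mem_faceSet]
    simpa [Finset.map_map, ← Equiv.trans_toEmbedding] using this

/-! ### The action of the symmetric and dihedral groups -/

theorem moveSegment_mul (γ δ : DihedralGroup (n + 3)) (e : Sym2 (Vertex n)) :
    moveSegment (γ * δ) e = moveSegment γ (moveSegment δ e) := by
  induction e with | _ a b => simp [moveSegment_mk]

theorem moveSegment_one (e : Sym2 (Vertex n)) : moveSegment 1 e = e := by
  induction e with | _ a b => simp [moveSegment_mk]

theorem ColoredTriangulation.move_one (t : ColoredTriangulation n) : t.move 1 = t := by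
  ext1
  funext k
  exact moveSegment_one _

theorem ColoredTriangulation.move_mul (γ δ : DihedralGroup (n + 3)) (t : ColoredTriangulation n) :
    t.move (γ * δ) = (t.move δ).move γ := by
  ext1
  funext k
  exact moveSegment_mul _ _ _

/-- The action of `S_n × D_{n+3}` on the colored triangulations. -/
def symmAction (n : ℕ) : Equiv.Perm (Fin n) × DihedralGroup (n + 3) →*
    Equiv.Perm (ColoredTriangulation n) :=
  MonoidHom.toHomPerm
    { toFun := fun p t => (t.move p.2).recolor p.1
      map_one' := funext fun t => t.move_one
      map_mul' := fun p q => funext fun t => by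
        change (t.move (p.2 * q.2)).recolor (p.1 * q.1) =
          (((t.move q.2).recolor q.1).move p.2).recolor p.1
        rw [move_mul, recolor_mul]
        rfl }

theorem symmAction_apply (p : Equiv.Perm (Fin n) × DihedralGroup (n + 3))
    (t : ColoredTriangulation n) : symmAction n p t = (t.move p.2).recolor p.1 := rfl

theorem symmAction_flip (p : Equiv.Perm (Fin n) × DihedralGroup (n + 3))
    (t : ColoredTriangulation n) (c : Fin n) :
    symmAction n p (t.flip c) = (symmAction n p t).flip (p.1 c) := by
  rw [symmAction_apply, symmAction_apply, move_flip, recolor_flip]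

/-- The action of a pair of a permutation of the colors and a symmetry of the polygon on the
faces. -/
def faceAction (p : Equiv.Perm (Fin n) × DihedralGroup (n + 3)) (F : ColorfulAssociahedron n) :
    ColorfulAssociahedron n :=
  ⟨symmAction n p '' F.1, by
    rcases F.2 with h | ⟨C, t, h⟩
    · left
      rw [h, Set.image_empty]
    · right
      exact ⟨_, _, by rw [h, image_faceSet _ p.1 (symmAction_flip p)]⟩⟩

theorem faceAction_one (F : ColorfulAssociahedron n) : faceAction 1 F = F := by
  apply Subtype.ext
  change symmAction n 1 '' F.1 = F.1
  rw [map_one, Equiv.Perm.coe_one, Set.image_id]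

theorem faceAction_mul (p q : Equiv.Perm (Fin n) × DihedralGroup (n + 3))
    (F : ColorfulAssociahedron n) : faceAction (p * q) F = faceAction p (faceAction q F) := by
  apply Subtype.ext
  change symmAction n (p * q) '' F.1 = symmAction n p '' (symmAction n q '' F.1)
  rw [map_mul, Equiv.Perm.coe_mul, Set.image_comp]

theorem faceAction_face (p : Equiv.Perm (Fin n) × DihedralGroup (n + 3)) (C : Finset (Fin n))
    (t : ColoredTriangulation n) :
    faceAction p (face C t) = face (C.map p.1.toEmbedding) ((t.move p.2).recolor p.1) :=
  Subtype.ext (image_faceSet _ p.1 (symmAction_flip p) C t)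

/-- The group homomorphism from `S_n × D_{n+3}` to the automorphisms of the colorful
associahedron. -/
def faceActionHom (n : ℕ) : Equiv.Perm (Fin n) × DihedralGroup (n + 3) →*
    (ColorfulAssociahedron n ≃o ColorfulAssociahedron n) where
  toFun p :=
    { toFun := faceAction p
      invFun := faceAction p⁻¹
      left_inv := fun F => by rw [← faceAction_mul, inv_mul_cancel, faceAction_one]
      right_inv := fun F => by rw [← faceAction_mul, mul_inv_cancel, faceAction_one]
      map_rel_iff' := Set.image_subset_image_iff (symmAction n p).injective }
  map_one' := by
    exact RelIso.ext faceAction_one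
  map_mul' p q := by
    exact RelIso.ext (faceAction_mul p q)

theorem faceActionHom_apply (p : Equiv.Perm (Fin n) × DihedralGroup (n + 3))
    (F : ColorfulAssociahedron n) : faceActionHom n p F = faceAction p F := rfl

theorem face_empty_injective {t t' : ColoredTriangulation n} (h : face ∅ t = face ∅ t') :
    t = t' := by
  have := congrArg Subtype.val h
  change faceSet ∅ t = faceSet ∅ t' at this
  rwa [faceSet_empty, faceSet_empty, Set.singleton_eq_singleton_iff] at this

theorem polygonSymm_injective : Function.Injective (polygonSymm n) := by
  rw [injective_iff_map_eq_one]
  rintro (i | i) h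
  · have h0 := Equiv.congr_fun h 0
    rw [polygonSymm_r, zero_add, Equiv.Perm.one_apply] at h0
    rw [h0]
    rfl
  · exfalso
    have h0 := Equiv.congr_fun h 0
    have h1 := Equiv.congr_fun h 1
    rw [polygonSymm_sr, Equiv.Perm.one_apply] at h0 h1
    have h2 : ((2 : ℕ) : Vertex n) = ((0 : ℕ) : Vertex n) := by
      push_cast
      linear_combination h0 - h1
    exact natCast_vertex_ne (by omega) (by omega) (by omega) h2

/-- A symmetry which maps all diagonals of the fan at a vertex to diagonals of this fan fixes the
vertex. -/
theorem polygonSymm_eq_of_fan (hn : 2 ≤ n) {σ : Equiv.Perm (Fin n)} {γ : DihedralGroup (n + 3)}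
    {v : Vertex n} (h : (((fan n).move (.r v)).move γ).recolor σ = (fan n).move (.r v)) :
    polygonSymm n γ v = v := by
  have hd : ∀ t : ColoredTriangulation n, t = (fan n).move (.r v) → ∀ k, v ∈ t.diag k := by
    rintro _ rfl k
    rw [move_diag, fan_diag, moveSegment_mk, polygonSymm_r, polygonSymm_r, zero_add]
    exact Sym2.mem_mk_left _ _
  have hi : ∀ i, v ∈ moveSegment γ (((fan n).move (.r v)).diag i) := by
    intro i
    have := hd _ h (σ i)
    rwa [recolor_diag, move_diag, perm_inv_apply_apply] at this
  -- Otherwise `γ` would send the other ends of the diagonals of colors `0` and `1` both to `v`.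
  by_contra hne
  have hk : ∀ i : Fin n, v = polygonSymm n γ (((i + 2 : ℕ) : Vertex n) + v) := by
    intro i
    have := hi i
    rw [move_diag, fan_diag, moveSegment_mk, moveSegment_mk, polygonSymm_r, polygonSymm_r,
      zero_add, Sym2.mem_iff] at this
    exact this.resolve_left (Ne.symm hne)
  have h01 := (polygonSymm n γ).injective
    ((hk ⟨0, by omega⟩).symm.trans (hk ⟨1, by omega⟩))
  exact natCast_vertex_ne (by omega) (by omega) (by simp) (add_right_cancel h01)

theorem faceActionHom_injective (hn : 2 ≤ n) : Function.Injective (faceActionHom n) := by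
  rw [injective_iff_map_eq_one]
  rintro ⟨σ, γ⟩ h
  have key : ∀ t : ColoredTriangulation n, (t.move γ).recolor σ = t := by
    intro t
    have := congrFun (congrArg DFunLike.coe h) (face ∅ t)
    rw [faceActionHom_apply, faceAction_face] at this
    exact face_empty_injective this
  have hγ : γ = 1 := by
    apply polygonSymm_injective
    rw [map_one]
    exact Equiv.ext fun v => polygonSymm_eq_of_fan hn (key _)
  subst hγ
  refine Prod.ext (Equiv.ext fun c => ?_) rfl
  have h1 := congrArg (fun t => t.diag (σ c)) (key (fan n))
  simp only [move_one, recolor_diag, perm_inv_apply_apply] at h1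
  exact ((fan n).injective h1).symm

/-! ### The automorphisms of the colorful associahedron -/

instance : OrderBot (ColorfulAssociahedron n) where
  bot := ⟨∅, Or.inl rfl⟩
  bot_le F := Set.empty_subset F.1

theorem isAtom_iff_face_empty {F : ColorfulAssociahedron n} :
    IsAtom F ↔ ∃ t, F = face ∅ t := by
  constructor
  · intro h
    have hne : F.1.Nonempty := by
      rw [Set.nonempty_iff_ne_empty]
      exact fun h0 => h.1 (Subtype.ext h0)
    obtain ⟨t, ht⟩ := hne
    refine ⟨t, ?_⟩
    have hle : face ∅ t ≤ F := by
      change faceSet ∅ t ⊆ F.1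
      rw [faceSet_empty]
      exact Set.singleton_subset_iff.2 ht
    refine ((h.le_iff.1 hle).resolve_left fun h0 => ?_).symm
    have : t ∈ (face ∅ t).1 := self_mem_faceSet _ _
    rw [h0] at this
    exact this
  · rintro ⟨t, rfl⟩
    refine ⟨fun h0 => ?_, fun G hG => ?_⟩
    · have : t ∈ (face ∅ t).1 := self_mem_faceSet _ _
      rw [h0] at this
      exact this
    · have hG : G.1 ⊂ {t} := by
        rw [← faceSet_empty]
        exact hG
      exact Subtype.ext (Set.ssubset_singleton_iff.1 hG)

theorem face_empty_le_iff {t : ColoredTriangulation n} {F : ColorfulAssociahedron n} :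
    face ∅ t ≤ F ↔ t ∈ F.1 := by
  change faceSet ∅ t ⊆ F.1 ↔ t ∈ F.1
  rw [faceSet_empty, Set.singleton_subset_iff]

/-- An automorphism of the colorful associahedron is induced by a permutation of its vertices. -/
theorem exists_perm_of_orderIso (φ : ColorfulAssociahedron n ≃o ColorfulAssociahedron n) :
    ∃ f : Equiv.Perm (ColoredTriangulation n), ∀ F, (φ F).1 = f '' F.1 := by
  have hex : ∀ (ψ : ColorfulAssociahedron n ≃o ColorfulAssociahedron n) t,
      ∃ u, ψ (face ∅ t) = face ∅ u := fun ψ t =>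
    isAtom_iff_face_empty.1 ((ψ.isAtom_iff _).2 (isAtom_iff_face_empty.2 ⟨t, rfl⟩))
  choose f hf using hex φ
  choose g hg using hex φ.symm
  refine ⟨⟨f, g, fun t => ?_, fun t => ?_⟩, fun F => ?_⟩
  · apply face_empty_injective
    rw [← hg, ← hf, OrderIso.symm_apply_apply]
  · apply face_empty_injective
    rw [← hf, ← hg, OrderIso.apply_symm_apply]
  · ext u
    have h1 : ∀ t, f t ∈ (φ F).1 ↔ t ∈ F.1 := by
      intro t
      rw [← face_empty_le_iff, ← hf, φ.le_iff_le, face_empty_le_iff]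
    have h2 : f (g u) = u := by
      apply face_empty_injective
      rw [← hf, ← hg, OrderIso.apply_symm_apply]
    constructor
    · intro hu
      refine ⟨g u, ?_, h2⟩
      rwa [← h1, h2]
    · rintro ⟨t, ht, rfl⟩
      exact (h1 t).2 ht

theorem exists_image_faceSet_eq {φ : ColorfulAssociahedron n ≃o ColorfulAssociahedron n}
    {f : Equiv.Perm (ColoredTriangulation n)} (hf : ∀ F, (φ F).1 = f '' F.1)
    (C : Finset (Fin n)) (t : ColoredTriangulation n) :
    ∃ D, f '' faceSet C t = faceSet D (f t) := by
  have hmem : f t ∈ f '' faceSet C t := Set.mem_image_of_mem f (self_mem_faceSet C t)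
  have h := hf (face C t)
  change _ = f '' faceSet C t at h
  rcases (φ (face C t)).2 with h0 | ⟨D, u, hD⟩
  · rw [← h, h0] at hmem
    exact absurd hmem (Set.notMem_empty _)
  · refine ⟨D, ?_⟩
    rw [← h, hD] at hmem
    rw [← h, hD, faceSet_eq_of_mem hmem]

/-- A permutation of the colored triangulations which maps faces to faces permutes the colors of
the flips. -/
theorem exists_perm_colors {f : Equiv.Perm (ColoredTriangulation n)}
    (hf : ∀ C t, ∃ D, f '' faceSet C t = faceSet D (f t)) :
    ∃ σ : Equiv.Perm (Fin n), ∀ t c, f (t.flip c) = (f t).flip (σ c) := by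
  have hex : ∀ t c, ∃ d, f (t.flip c) = (f t).flip d := by
    intro t c
    -- The image of an edge has two elements, so `D` has a color `d`, and the flip of `d` at `f t`
    -- must be the second element.
    obtain ⟨D, hD⟩ := hf {c} t
    rw [faceSet_singleton, Set.image_pair] at hD
    have hmem : f (t.flip c) ∈ faceSet D (f t) := hD ▸ Set.mem_insert_of_mem _ rfl
    rcases D.eq_empty_or_nonempty with rfl | ⟨d, hd⟩
    · rw [faceSet_empty] at hmem
      exact absurd (f.injective hmem) (t.flip_ne c)
    · refine ⟨d, ?_⟩
      have h := flip_mem_faceSet_iff (t := f t).2 hd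
      rw [← hD] at h
      exact (h.resolve_left ((f t).flip_ne d)).symm
  choose σ hσ using hex
  have hinj : ∀ t, Function.Injective (σ t) := fun t c d hcd =>
    t.flip_injective (f.injective (by rw [hσ, hσ, hcd]))
  have hmem : ∀ {C D t}, f '' faceSet C t = faceSet D (f t) → ∀ c, σ t c ∈ D ↔ c ∈ C := by
    intro C D t h c
    rw [← flip_mem_faceSet_iff (t := f t), ← hσ, ← h, f.injective.mem_set_image,
      flip_mem_faceSet_iff]
  have hstep : ∀ t c, σ (t.flip c) = σ t := by
    intro t c
    -- The edge of color `c` is the same seen from both ends.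
    have hc : σ (t.flip c) c = σ t c := by
      apply (f (t.flip c)).flip_injective
      rw [← hσ, ColoredTriangulation.flip_flip, hσ, ColoredTriangulation.flip_flip]
    funext d
    by_cases hcd : d = c
    · rw [hcd, hc]
    -- The face `({c, d}, t)` also contains `t.flip c`, so `σ t` and `σ (t.flip c)` both map `{c,
    -- d}` onto the colors `D` of its image. They agree at `c`, hence at `d`.
    obtain ⟨D, hD⟩ := hf {c, d} t
    have hflip : t.flip c ∈ faceSet {c, d} t := flip_mem_faceSet_iff.2 (by simp)
    have hD' : f '' faceSet {c, d} (t.flip c) = faceSet D (f (t.flip c)) := by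
      rw [← faceSet_eq_of_mem hflip, hD]
      exact faceSet_eq_of_mem (hD ▸ Set.mem_image_of_mem f hflip)
    obtain ⟨e, he⟩ := Finite.surjective_of_injective (hinj (t.flip c)) (σ t d)
    have h1 := (hmem hD d).2 (by simp)
    rw [← he, hmem hD', Finset.mem_insert, Finset.mem_singleton] at h1
    rcases h1 with rfl | rfl
    · rw [hc] at he
      exact absurd (hinj t he).symm hcd
    · exact he
  refine ⟨Equiv.ofBijective (σ (fan n)) (Finite.injective_iff_bijective.1 (hinj _)),
    fun t c => ?_⟩
  rw [hσ, Equiv.ofBijective_apply,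
    flip_induction (P := fun t => σ t = σ (fan n)) rfl (fun t c ht => (hstep t c).trans ht) t]

theorem faceActionHom_surjective (hn : 2 ≤ n) : Function.Surjective (faceActionHom n) := by
  intro φ
  obtain ⟨f, hf⟩ := exists_perm_of_orderIso φ
  obtain ⟨σ, hσ⟩ := exists_perm_colors (exists_image_faceSet_eq hf)
  -- Undoing the color permutation makes the map commute with flips.
  obtain ⟨γ, hγ⟩ := exists_eq_move hn (g := fun t => (f t).recolor σ⁻¹)
    (fun t u htu => f.injective (by
      have := congrArg (recolor σ) htu
      simpa only [← recolor_mul, mul_inv_cancel, recolor_one] using this))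
    (fun t c => by rw [hσ, recolor_flip, perm_inv_apply_apply])
  refine ⟨(σ, γ), ?_⟩
  refine RelIso.ext fun F => Subtype.ext ?_
  rw [hf]
  change symmAction n (σ, γ) '' F.1 = _
  refine Set.image_congr fun t _ => ?_
  rw [symmAction_apply, ← hγ, ← recolor_mul, mul_inv_cancel, recolor_one]

end ColAssoc

open ColAssoc
theorem theorem5p6 (n : ℕ) (hn : 2 ≤ n) :
    ∃ Φ : Equiv.Perm (Fin n) × DihedralGroup (n + 3) ≃*
        (ColorfulAssociahedron n ≃o ColorfulAssociahedron n),
      (∀ (σ : Equiv.Perm (Fin n)) (C : Finset (Fin n)) (t : ColoredTriangulation n),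
        Φ (σ, 1) (face C t) = face (C.map σ.toEmbedding) (t.recolor σ)) ∧
      (∀ (γ : DihedralGroup (n + 3)) (C : Finset (Fin n)) (t : ColoredTriangulation n),
        Φ (1, γ) (face C t) = face C (t.move γ)) := by
  refine ⟨MulEquiv.ofBijective (faceActionHom n)
    ⟨faceActionHom_injective hn, faceActionHom_surjective hn⟩, fun σ C t => ?_, fun γ C t => ?_⟩
  · exact (faceAction_face (σ, 1) C t).trans (by rw [ColoredTriangulation.move_one])
  · refine (faceAction_face (1, γ) C t).trans ?_
    rw [ColoredTriangulation.recolor_one]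
    congr 1
    exact Finset.map_refl
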